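/- Let $1\le q<\infty$ and let $D=i\,\frac{d}{dt}$ in $L_q(\mathbb R_+)$, with domain the set of all $u\in L_q(\mathbb R_+)$ that are absolutely continuous on every bounded interval of the positive semi-axis and satisfy $u'\in L_q(\mathbb R_+)$. Consider in $L_q(\mathbb R_+)$ the perturbed Hill operator $$(Hu)(t)=(D^2u)(t)+V(t)u(t)+b_1(t)(Du)(t)+b_2(t)u(t)+\int_0^\infty k_1(t,s)(Du)(s)\,ds+\int_0^\infty k_2(t,s)u(s)\,ds ,\qquad u\in W_q^2(\mathbb R_+),$$ where all coefficients and kernels are complex-valued, $V\in L_\infty$ is periodic, $V(t+1)=V(t)$, and $k_1,k_2\in L_\infty(\mathbb R_+\times\mathbb R_+)$. Suppose that for some $\delta>2$ and $j=1,2$: (i) $(1+t)^{\delta}b_j(t)\in L_\infty(\mathbb R_+)$; (ii) $k_j(t,s)=0$ for $t>s$; (iii) the integral operator with kernel $(1+t)^{\delta}k_j(t,s)$ is bounded on $L_q(\mathbb R_+)$. Then no extreme point (endpoint) of the continuous spectrum of $H$ is an eigenvalue of $H$. Here the continuous spectrum of $H$ is the set of all $z\in\mathbb C$ for which the range of $H-zI$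 is not closed in $L_q(\mathbb R_+)$ (so it may a priori contain eigenvalues). An extreme point of a set $S\subseteq\mathbb C$ is a point $z$ of its closure that is not an inner point, where $z\in S$ is called inner if it has an open neighbourhood $U$ such that $S\cap U$ is homeomorphic to $\mathbb R$ (an open arc); for $S\subseteq\mathbb R$ these are exactly the boundary points of $S$ relative to $\mathbb R$. -/

import Mathlib

open MeasureTheory Set Filter Topology
open scoped ENNReal NNReal

noncomputable section

namespace Hill

/-- Lebesgue measure on the half-line `ℝ₊ = (0, ∞)`. -/
abbrev halfLine : Measure ℝ := volume.restrict (Ioi (0 : ℝ))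

/-- The complex Banach space `L_q(ℝ₊)`. -/
abbrev LpHalf (q : ℝ≥0∞) := Lp ℂ q halfLine

/-- `v` is the generalized derivative of `u` in `L_q(ℝ₊)`: `u` has a representative `w` that is
absolutely continuous on every bounded interval of the positive semi-axis and `w' = v` almost
everywhere. -/
def HasLpDeriv {q : ℝ≥0∞} (u v : LpHalf q) : Prop :=
  ∃ w : ℝ → ℂ, (∀ b : ℝ, 0 < b → AbsolutelyContinuousOnInterval w 0 b) ∧
    (∀ᵐ t ∂halfLine, u t = w t) ∧ ∀ᵐ t ∂halfLine, HasDerivAt w (v t) t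

theorem HasLpDeriv.unique {q : ℝ≥0∞} {u v v' : LpHalf q}
    (h : HasLpDeriv u v) (h' : HasLpDeriv u v') : v = v' := by
  obtain ⟨w, hw, huw, hd⟩ := h
  obtain ⟨w', hw', huw', hd'⟩ := h'
  have cont : ∀ f : ℝ → ℂ, (∀ b : ℝ, 0 < b → AbsolutelyContinuousOnInterval f 0 b) →
      ContinuousOn f (Ioi 0) := by
    intro f hf x hx
    have hx0 : (0 : ℝ) < x := hx
    have h1 := (hf (x + 1) (by linarith)).continuousOn
    rw [uIcc_of_le (by linarith)] at h1
    exact (h1.continuousAt (Icc_mem_nhds hx0 (by linarith))).continuousWithinAt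
  have heq : EqOn w w' (Ioi 0) := by
    refine Measure.eqOn_open_of_ae_eq (μ := volume) ?_ isOpen_Ioi (cont w hw) (cont w' hw')
    filter_upwards [huw, huw'] with t h1 h2
    rw [← h1, ← h2]
  apply Lp.ext
  filter_upwards [hd, hd', ae_restrict_mem measurableSet_Ioi] with t h1 h2 ht
  exact h1.unique (h2.congr_of_eventuallyEq (heq.eventuallyEq_of_mem (isOpen_Ioi.mem_nhds ht)))

/-- The graph of the operator `D = i d/dx` in `L_q(ℝ₊)`: `u ∈ Dom D` and `D u = v`. -/
def IsD {q : ℝ≥0∞} (u v : LpHalf q) : Prop :=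
  ∃ u' : LpHalf q, HasLpDeriv u u' ∧ v = Complex.I • u'

theorem IsD.unique {q : ℝ≥0∞} {u v v' : LpHalf q} (h : IsD u v) (h' : IsD u v') : v = v' := by
  obtain ⟨a, ha, rfl⟩ := h
  obtain ⟨b, hb, rfl⟩ := h'
  rw [ha.unique hb]

/-- The graph of the perturbed Hill operator
`H u = D² u + V u + b₁ D u + b₂ u + ∫ k₁(·,s) (D u)(s) ds + ∫ k₂(·,s) u(s) ds` on the domain of
those `u ∈ W_q²(ℝ₊)` (that is, `u ∈ Dom D` and `D u ∈ Dom D`) for which the right-hand side is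
in `L_q(ℝ₊)`: `u ∈ Dom H` and `H u = f`. -/
def IsHill {q : ℝ≥0∞} (V b₁ b₂ : ℝ → ℂ) (k₁ k₂ : ℝ → ℝ → ℂ) (u f : LpHalf q) : Prop :=
  ∃ u₁ u₂ : LpHalf q, IsD u u₁ ∧ IsD u₁ u₂ ∧
    ∀ᵐ t ∂halfLine,
      f t = u₂ t + V t * u t + b₁ t * u₁ t + b₂ t * u t
        + (∫ s, k₁ t s * u₁ s ∂halfLine) + (∫ s, k₂ t s * u s ∂halfLine)

theorem IsHill.unique {q : ℝ≥0∞} {V b₁ b₂ : ℝ → ℂ} {k₁ k₂ : ℝ → ℝ → ℂ} {u f f' : LpHalf q}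
    (h : IsHill V b₁ b₂ k₁ k₂ u f) (h' : IsHill V b₁ b₂ k₁ k₂ u f') : f = f' := by
  obtain ⟨u₁, u₂, h1, h2, hf⟩ := h
  obtain ⟨v₁, v₂, h1', h2', hf'⟩ := h'
  obtain rfl := h1.unique h1'
  obtain rfl := h2.unique h2'
  apply Lp.ext
  filter_upwards [hf, hf'] with t e e'
  rw [e, e']

/-- The integral operator with kernel `k` is (everywhere defined and) bounded in `L_q(ℝ₊)`. -/
def IsBoundedKernel (q : ℝ≥0∞) (k : ℝ → ℝ → ℂ) : Prop :=
  ∃ C : ℝ≥0, ∀ u : LpHalf q,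
    (∀ᵐ t ∂halfLine, Integrable (fun s => k t s * u s) halfLine) ∧
    MemLp (fun t => ∫ s, k t s * u s ∂halfLine) q halfLine ∧
    eLpNorm (fun t => ∫ s, k t s * u s ∂halfLine) q halfLine ≤ C * eLpNorm u q halfLine

section Spectrum

variable {E : Type*} [NormedAddCommGroup E] [NormedSpace ℂ E]

/-- `z` is an eigenvalue of the operator with graph `T` (`T u f` means `u ∈ Dom` and
`f` is the image of `u`). -/
def IsEigenvalue (T : E → E → Prop) (z : ℂ) : Prop :=
  ∃ u : E, u ≠ 0 ∧ T u (z • u)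

/-- The range of `T - z I`, for the operator with graph `T`. -/
def rangeSub (T : E → E → Prop) (z : ℂ) : Set E :=
  {g | ∃ u f : E, T u f ∧ g = f - z • u}

/-- The continuous spectrum (which may contain eigenvalues): the set of those `z` for which the
range of `T - z I` is not closed. -/
def continuousSpectrum (T : E → E → Prop) : Set ℂ :=
  {z | ¬ IsClosed (rangeSub T z)}

end Spectrum

/-- `z` is an extreme point (endpoint) of `S ⊆ ℂ`: it lies in the closure of `S`, and it is not
an inner point, i.e. near `z` the set `S` is not an open arc through `z`. For `S ⊆ ℝ` these are
precisely the boundary points of `S` relative to `ℝ`. -/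
def IsExtremePoint (S : Set ℂ) (z : ℂ) : Prop :=
  z ∈ closure S ∧
    ¬ (z ∈ S ∧ ∃ U : Set ℂ, IsOpen U ∧ z ∈ U ∧ Nonempty (↥(S ∩ U) ≃ₜ ℝ))

end Hill

end

/-! Fix z and put W = V - z. The monodromy matrix of u'' = W u over one period has determinant 1, so
its eigenvalues are ρ and ρ⁻¹ with |ρ| ≤ 1, and everything depends on whether |ρ| < 1 or |ρ| = 1.

If |ρ| < 1, the equation has an exponential dichotomy, and H - z has a bounded right inverse
(`IsCanonical.exists_right_inverse`). For z' near z the range of H - z' is then the whole space, so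
z is outside the closure of the continuous spectrum (`notMem_closure_continuousSpectrum`).

If |ρ| = 1, unperturbed solutions grow at most linearly and only the zero solution lies in L_q.
Variation of constants from infinity has a weighted kernel of size (1 + s)^(1 - δ), integrable
because δ > 2. It turns the eigenvalue equation into (1 - K) x = 0 with 1 - K invertible, so the
eigenfunction vanishes (`IsCanonical.eq_zero_of_isSol`). Hence no point of the closure of the
continuous spectrum is an eigenvalue.

Both cases need 1 + K to be invertible although K is not small. Since k_j(t, s) = 0 for t > s, the
restriction of K u to (a, ∞) depends only on that of u. On a far tail (T, ∞) the weight makes K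
small; on (0, T] a fine partition makes K block triangular with diagonal blocks of norm O(length).
`isUnit_one_add_of_triangular` assembles these pieces. -/

namespace Hill

/-! ### Invertibility of triangular elements of a ring. -/

theorem isUnit_one_add_of_mul_mul_one_sub_eq_zero {R : Type*} [Ring R] {p A : R} (hp : p * p = p)
    (h : p * A * (1 - p) = 0) (h1 : IsUnit (1 + p * A * p))
    (h2 : IsUnit (1 + (1 - p) * A * (1 - p))) : IsUnit (1 + A) := by
  have hp1 : p * (1 - p) = 0 := by rw [mul_sub, mul_one, hp, sub_self]
  have hN : IsUnit (1 + (1 - p) * A * p) := by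
    have hsq : ((1 - p) * A * p) * ((1 - p) * A * p) = 0 := by
      calc _ = (1 - p) * A * (p * (1 - p)) * A * p := by noncomm_ring
        _ = 0 := by rw [hp1]; noncomm_ring
    refine ⟨⟨1 + (1 - p) * A * p, 1 - (1 - p) * A * p, ?_, ?_⟩, rfl⟩
    · calc _ = 1 - ((1 - p) * A * p) * ((1 - p) * A * p) := by noncomm_ring
        _ = 1 := by rw [hsq, sub_zero]
    · calc _ = 1 - ((1 - p) * A * p) * ((1 - p) * A * p) := by noncomm_ring
        _ = 1 := by rw [hsq, sub_zero]
  -- Block triangular factorization; the middle factor is unipotent because its off-diagonal block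
  -- squares to zero.
  have key : 1 + A = (1 + p * A * p) * (1 + (1 - p) * A * p) * (1 + (1 - p) * A * (1 - p)) := by
    have e1 : (1 + p * A * p) * (1 + (1 - p) * A * p) = 1 + p * A * p + (1 - p) * A * p := by
      calc _ = 1 + p * A * p + (1 - p) * A * p + p * A * (p * (1 - p)) * A * p := by noncomm_ring
        _ = _ := by rw [hp1]; noncomm_ring
    rw [e1]
    calc 1 + A = 1 + p * A * p + (1 - p) * A * p + (1 - p) * A * (1 - p)
          + p * A * (1 - p) := by noncomm_ring
      _ = 1 + p * A * p + (1 - p) * A * p + (1 - p) * A * (1 - p)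
          + p * A * (p * (1 - p)) * A * (1 - p)
          + (1 - p) * A * (p * (1 - p)) * A * (1 - p) := by rw [h, hp1]; noncomm_ring
      _ = _ := by noncomm_ring
  rw [key]
  exact (h1.mul hN).mul h2

theorem isUnit_one_add_of_norm_lt_one {R : Type*} [NormedRing R] [CompleteSpace R] {A : R}
    (h : ‖A‖ < 1) : IsUnit (1 + A) := by
  have := (Units.oneSub (-A) (by rwa [norm_neg])).isUnit
  simpa using this

/-- An operator that is triangular with respect to a decreasing chain of projections, has a small
tail and small diagonal blocks, does not have `-1` in its spectrum. -/
theorem isUnit_one_add_of_triangular {R : Type*} [NormedRing R] [CompleteSpace R] {p : ℝ → R}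
    {T C : ℝ} {A : R} (hT : 0 ≤ T) (h0 : p 0 = 1)
    (hp : ∀ a b, 0 ≤ a → a ≤ b → b ≤ T → p a * p b = p b ∧ p b * p a = p b)
    (htri : ∀ a, 0 ≤ a → a ≤ T → p a * A * p a = p a * A)
    (htail : ‖p T * A * p T‖ < 1)
    (hloc : ∀ a b, 0 ≤ a → a ≤ b → b ≤ T → ‖(p a - p b) * A * (p a - p b)‖ ≤ C * (b - a)) :
    IsUnit (1 + A) := by
  -- `|C| + 1` because nothing is assumed about the sign of `C`.
  obtain ⟨ε, hε, hCε⟩ : ∃ ε : ℝ, 0 < ε ∧ C * ε < 1 := by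
    refine ⟨1 / (2 * (|C| + 1)), by positivity, ?_⟩
    have h1 : 0 < |C| + 1 := by positivity
    rw [mul_one_div, div_lt_one (by positivity)]
    nlinarith [le_abs_self C, abs_nonneg C]
  -- Descend from T to 0 in steps of ε. Each step adjoins the diagonal block between a and b, of
  -- norm below 1, to a compression already known to be invertible.
  have step : ∀ n : ℕ, IsUnit (1 + p (max (T - n * ε) 0) * A * p (max (T - n * ε) 0)) := by
    intro n
    induction n with
    | zero =>
      simp only [Nat.cast_zero, zero_mul, sub_zero, max_eq_left hT]
      exact isUnit_one_add_of_norm_lt_one htail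
    | succ n ih =>
      have hnε : 0 ≤ n * ε := by positivity
      set b := max (T - n * ε) 0 with hb
      set a := max (T - (n + 1 : ℕ) * ε) 0 with ha
      have ha0 : 0 ≤ a := le_max_right _ _
      have hab : a ≤ b := by
        apply max_le_max _ le_rfl
        push_cast
        nlinarith
      have hbT : b ≤ T := max_le (by linarith) hT
      have hba : b - a ≤ ε := by
        rcases le_total (T - n * ε) 0 with h | h
        · rw [hb, max_eq_right h]; linarith
        · rw [hb, max_eq_left h]
          have : T - (n + 1 : ℕ) * ε ≤ a := le_max_left _ _
          push_cast at this
          linarith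
      obtain ⟨e1, e2⟩ := hp a b ha0 hab hbT
      have e3 := (hp b b (ha0.trans hab) le_rfl hbT).1
      have e4 := (hp a a ha0 le_rfl (hab.trans hbT)).1
      have f1 : p b * (p a * A * p a) * p b = p b * A * p b := by
        calc _ = (p b * p a) * A * (p a * p b) := by noncomm_ring
          _ = _ := by rw [e1, e2]
      refine isUnit_one_add_of_mul_mul_one_sub_eq_zero (p := p b) e3 ?_ ?_ ?_
      · calc p b * (p a * A * p a) * (1 - p b) = (p b * p a) * A * (p a - p a * p b) := by
              noncomm_ring
          _ = p b * A * (p a - p b) := by rw [e1, e2]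
          _ = (p b * A * p b) * (p a - p b) := by rw [htri b (ha0.trans hab) hbT]
          _ = p b * A * (p b * p a - p b * p b) := by noncomm_ring
          _ = 0 := by rw [e2, e3]; noncomm_ring
      · rw [f1]; exact ih
      · have f2 : (1 - p b) * (p a * A * p a) * (1 - p b) = (p a - p b) * A * (p a - p b) := by
          calc _ = (p a - p b * p a) * A * (p a - p a * p b) := by noncomm_ring
            _ = _ := by rw [e1, e2]
        rw [f2]
        apply isUnit_one_add_of_norm_lt_one
        refine (hloc a b ha0 hab hbT).trans_lt ?_
        rcases le_total C 0 with hC | hC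
        · nlinarith
        · nlinarith
  obtain ⟨n, hn⟩ := exists_nat_gt (T / ε)
  have hn' : T - n * ε ≤ 0 := by
    rw [div_lt_iff₀ hε] at hn; linarith
  have := step n
  rwa [max_eq_right hn', h0, one_mul, mul_one] at this

/-! ### Jensen's inequality and the Schur test. -/

/-- Jensen's inequality for the power `p ≥ 1` and a weight of finite mass. -/
theorem lintegral_mul_rpow_le {α : Type*} [MeasurableSpace α] {μ : Measure α} {w f : α → ℝ≥0∞}
    {p : ℝ} (hp : 1 ≤ p) (hw : AEMeasurable w μ) (hf : AEMeasurable f μ) :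
    (∫⁻ s, w s * f s ∂μ) ^ p ≤ (∫⁻ s, w s ∂μ) ^ (p - 1) * ∫⁻ s, w s * f s ^ p ∂μ := by
  rcases hp.eq_or_lt with rfl | hp
  · simp
  have hc : p.HolderConjugate (p / (p - 1)) := Real.HolderConjugate.conjExponent hp
  have hp0 : 0 < p := by linarith
  have hp1 : 0 < p - 1 := by linarith
  -- Split w = w^(1/p) · w^((p-1)/p) and apply Hölder.
  have e : ∀ s, w s * f s = (w s ^ (1 / p) * f s) * w s ^ ((p - 1) / p) := by
    intro s
    rw [mul_right_comm, ← ENNReal.rpow_add_of_nonneg _ _ (by positivity) (by positivity)]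
    congr 1
    rw [← add_div, add_sub_cancel, div_self hp0.ne', ENNReal.rpow_one]
  have h := ENNReal.lintegral_mul_le_Lp_mul_Lq μ hc ((hw.pow_const (1 / p)).mul hf)
    (hw.pow_const ((p - 1) / p))
  simp only [Pi.mul_apply] at h
  have h' : ∫⁻ s, w s * f s ∂μ ≤ (∫⁻ s, w s * f s ^ p ∂μ) ^ (1 / p)
      * (∫⁻ s, w s ∂μ) ^ ((p - 1) / p) := by
    calc _ = ∫⁻ s, (w s ^ (1 / p) * f s) * w s ^ ((p - 1) / p) ∂μ := by simp_rw [← e]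
      _ ≤ _ := h
      _ = _ := by
        congr 2
        · apply lintegral_congr
          intro s
          rw [ENNReal.mul_rpow_of_nonneg _ _ hp0.le, ← ENNReal.rpow_mul, one_div,
            inv_mul_cancel₀ hp0.ne', ENNReal.rpow_one]
        · apply lintegral_congr
          intro s
          rw [← ENNReal.rpow_mul, div_mul_div_cancel₀ hp0.ne', div_self hp1.ne', ENNReal.rpow_one]
        · field_simp
  calc _ ≤ ((∫⁻ s, w s * f s ^ p ∂μ) ^ (1 / p) * (∫⁻ s, w s ∂μ) ^ ((p - 1) / p)) ^ p :=
        ENNReal.rpow_le_rpow h' hp0.le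
    _ = _ := by
      rw [ENNReal.mul_rpow_of_nonneg _ _ hp0.le, ← ENNReal.rpow_mul, ← ENNReal.rpow_mul,
        div_mul_cancel₀ _ hp0.ne', div_mul_cancel₀ _ hp0.ne', ENNReal.rpow_one, mul_comm]

/-- The Schur test. -/
theorem lintegral_lintegral_mul_rpow_le {α : Type*} [MeasurableSpace α] {μ : Measure α}
    [SFinite μ] {κ : α → α → ℝ≥0∞} {f : α → ℝ≥0∞} {C : ℝ≥0∞} {p : ℝ} (hp : 1 ≤ p)
    (hκ : Measurable (Function.uncurry κ)) (hf : AEMeasurable f μ)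
    (h1 : ∀ᵐ t ∂μ, ∫⁻ s, κ t s ∂μ ≤ C) (h2 : ∀ᵐ s ∂μ, ∫⁻ t, κ t s ∂μ ≤ C) :
    ∫⁻ t, (∫⁻ s, κ t s * f s ∂μ) ^ p ∂μ ≤ C ^ p * ∫⁻ s, f s ^ p ∂μ := by
  have hm : AEMeasurable (Function.uncurry fun t s => κ t s * f s ^ p) (μ.prod μ) :=
    hκ.aemeasurable.mul ((hf.comp_snd).pow_const p)
  -- Jensen on each row costs C^(p-1); after Tonelli the column bound costs the remaining factor C.
  calc _ ≤ ∫⁻ t, C ^ (p - 1) * ∫⁻ s, κ t s * f s ^ p ∂μ ∂μ := by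
        apply lintegral_mono_ae
        filter_upwards [h1] with t ht
        refine (lintegral_mul_rpow_le hp (hκ.of_uncurry_left.aemeasurable) hf).trans ?_
        gcongr
    _ = C ^ (p - 1) * ∫⁻ s, ∫⁻ t, κ t s * f s ^ p ∂μ ∂μ := by
        have hm' : AEMeasurable (fun t => ∫⁻ s, κ t s * f s ^ p ∂μ) μ := hm.lintegral_prod_right'
        rw [lintegral_const_mul'' _ hm', lintegral_lintegral_swap hm]
    _ ≤ C ^ (p - 1) * ∫⁻ s, C * f s ^ p ∂μ := by
        refine mul_le_mul_right (lintegral_mono_ae ?_) _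
        filter_upwards [h2] with s hs
        rw [lintegral_mul_const _ (by exact hκ.of_uncurry_right)]
        gcongr
    _ = _ := by
        rw [lintegral_const_mul'' _ (hf.pow_const p), ← mul_assoc]
        congr 1
        conv_rhs => rw [← sub_add_cancel p 1, ENNReal.rpow_add_of_nonneg _ _ (by linarith) zero_le_one,
          ENNReal.rpow_one]

/-! ### Multiplication, integral and truncation operators in L_q. -/

section Operators

variable {q : ℝ≥0∞} [Fact (1 ≤ q)]

theorem exists_clm_of_ae (F : LpHalf q → ℝ → ℂ) (C : ℝ≥0)
    (hadd : ∀ u v, F (u + v) =ᵐ[halfLine] fun t => F u t + F v t)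
    (hsmul : ∀ (c : ℂ) u, F (c • u) =ᵐ[halfLine] fun t => c * F u t)
    (hmem : ∀ u, MemLp (F u) q halfLine)
    (hbd : ∀ u, eLpNorm (F u) q halfLine ≤ C * eLpNorm u q halfLine) :
    ∃ B : LpHalf q →L[ℂ] LpHalf q, ‖B‖ ≤ C ∧ ∀ u, B u =ᵐ[halfLine] F u := by
  let B : LpHalf q →ₗ[ℂ] LpHalf q :=
    { toFun := fun u => (hmem u).toLp
      map_add' := fun u v => by
        apply Lp.ext
        filter_upwards [(hmem (u + v)).coeFn_toLp, (hmem u).coeFn_toLp, (hmem v).coeFn_toLp,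
          Lp.coeFn_add (hmem u).toLp (hmem v).toLp, hadd u v] with t h1 h2 h3 h4 h5
        rw [h1, h4, Pi.add_apply, h2, h3, h5]
      map_smul' := fun c u => by
        apply Lp.ext
        filter_upwards [(hmem (c • u)).coeFn_toLp, (hmem u).coeFn_toLp,
          Lp.coeFn_smul c (hmem u).toLp, hsmul c u] with t h1 h2 h3 h4
        rw [h1, RingHom.id_apply, h3, Pi.smul_apply, h2, h4, smul_eq_mul] }
  refine ⟨B.mkContinuous C fun u => ?_, LinearMap.mkContinuous_norm_le _ C.2 _, fun u =>
    (hmem u).coeFn_toLp⟩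
  change ‖(hmem u).toLp‖ ≤ _
  rw [Lp.norm_toLp, Lp.norm_def, ← ENNReal.coe_toReal, ← ENNReal.toReal_mul]
  exact ENNReal.toReal_mono (ENNReal.mul_ne_top ENNReal.coe_ne_top (Lp.eLpNorm_ne_top u)) (hbd u)

theorem opNorm_le_of_eLpNorm_le {B : LpHalf q →L[ℂ] LpHalf q} {C : ℝ≥0}
    (h : ∀ u, eLpNorm (B u) q halfLine ≤ C * eLpNorm u q halfLine) : ‖B‖ ≤ C := by
  refine B.opNorm_le_bound C.2 fun u => ?_
  rw [Lp.norm_def, Lp.norm_def]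
  rw [← ENNReal.coe_toReal, ← ENNReal.toReal_mul]
  exact ENNReal.toReal_mono (ENNReal.mul_ne_top ENNReal.coe_ne_top (Lp.eLpNorm_ne_top u)) (h u)

theorem exists_mul_clm {m : ℝ → ℂ} {C : ℝ≥0} (hm : AEStronglyMeasurable m halfLine)
    (hC : ∀ᵐ t ∂halfLine, ‖m t‖ ≤ C) :
    ∃ B : LpHalf q →L[ℂ] LpHalf q, ‖B‖ ≤ C ∧ ∀ u, B u =ᵐ[halfLine] fun t => m t * u t := by
  have hle : ∀ u : LpHalf q, ∀ᵐ t ∂halfLine, ‖m t * u t‖ ≤ C * ‖u t‖ := by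
    intro u
    filter_upwards [hC] with t ht
    rw [norm_mul]
    gcongr
  refine exists_clm_of_ae (fun u t => m t * u t) C ?_ ?_ ?_ ?_
  · intro u v
    filter_upwards [Lp.coeFn_add u v] with t ht
    rw [ht, Pi.add_apply, mul_add]
  · intro c u
    filter_upwards [Lp.coeFn_smul c u] with t ht
    rw [ht, Pi.smul_apply, smul_eq_mul, mul_left_comm]
  · intro u
    exact (Lp.memLp u).of_le_mul (hm.mul (Lp.aestronglyMeasurable u)) (hle u)
  · intro u
    have := eLpNorm_le_mul_eLpNorm_of_ae_le_mul (hle u) q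
    rwa [ENNReal.ofReal_coe_nnreal] at this

theorem IsBoundedKernel.exists_clm {k : ℝ → ℝ → ℂ} (hk : IsBoundedKernel q k) :
    ∃ B : LpHalf q →L[ℂ] LpHalf q,
      ∀ u, B u =ᵐ[halfLine] fun t => ∫ s, k t s * u s ∂halfLine := by
  obtain ⟨C, hC⟩ := hk
  have hadd : ∀ u v : LpHalf q, (fun t => ∫ s, k t s * (u + v : LpHalf q) s ∂halfLine)
      =ᵐ[halfLine] fun t => (∫ s, k t s * u s ∂halfLine) + ∫ s, k t s * v s ∂halfLine := by
    intro u v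
    filter_upwards [(hC u).1, (hC v).1] with t h1 h2
    rw [← integral_add h1 h2]
    apply integral_congr_ae
    filter_upwards [Lp.coeFn_add u v] with s hs
    rw [hs, Pi.add_apply, mul_add]
  have hsmul : ∀ (c : ℂ) (u : LpHalf q), (fun t => ∫ s, k t s * (c • u : LpHalf q) s ∂halfLine)
      =ᵐ[halfLine] fun t => c * ∫ s, k t s * u s ∂halfLine := by
    intro c u
    filter_upwards with t
    rw [← integral_const_mul]
    apply integral_congr_ae
    filter_upwards [Lp.coeFn_smul c u] with s hs
    rw [hs, Pi.smul_apply, smul_eq_mul, mul_left_comm]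
  obtain ⟨B, -, hB⟩ := exists_clm_of_ae _ C hadd hsmul (fun u => (hC u).2.1) (fun u => (hC u).2.2)
  exact ⟨B, hB⟩

theorem one_le_toReal_of_fact (hq : q ≠ ∞) : 1 ≤ q.toReal := by
  rw [← ENNReal.toReal_one]
  exact ENNReal.toReal_mono hq Fact.out

theorem eLpNorm_le_of_schur (hq : q ≠ ∞) {κ : ℝ → ℝ → ℝ≥0∞} {C : ℝ≥0}
    (hκ : Measurable (Function.uncurry κ))
    (h1 : ∀ᵐ t ∂halfLine, ∫⁻ s, κ t s ∂halfLine ≤ C)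
    (h2 : ∀ᵐ s ∂halfLine, ∫⁻ t, κ t s ∂halfLine ≤ C) (u : LpHalf q) {v : ℝ → ℂ}
    (hv : ∀ᵐ t ∂halfLine, ‖v t‖ₑ ≤ ∫⁻ s, κ t s * ‖u s‖ₑ ∂halfLine) :
    eLpNorm v q halfLine ≤ C * eLpNorm u q halfLine := by
  have hp := one_le_toReal_of_fact hq
  have hq0 : q ≠ 0 := (zero_lt_one.trans_le (Fact.out : 1 ≤ q)).ne'
  have hp0 : 0 < q.toReal := by linarith
  rw [eLpNorm_eq_lintegral_rpow_enorm_toReal hq0 hq, eLpNorm_eq_lintegral_rpow_enorm_toReal hq0 hq]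
  calc _ ≤ ((C : ℝ≥0∞) ^ q.toReal * ∫⁻ s, ‖u s‖ₑ ^ q.toReal ∂halfLine) ^ (1 / q.toReal) := by
        gcongr
        refine le_trans (lintegral_mono_ae ?_) (lintegral_lintegral_mul_rpow_le hp hκ
          (Lp.aestronglyMeasurable u).enorm h1 h2)
        filter_upwards [hv] with t ht
        gcongr
    _ = _ := by
        rw [ENNReal.mul_rpow_of_nonneg _ _ (by positivity), ← ENNReal.rpow_mul,
          mul_one_div_cancel hp0.ne', ENNReal.rpow_one]

/-- The Schur test for the kernel `k` on `I × I`. -/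
def SchurBound (k : ℝ → ℝ → ℂ) (I : Set ℝ) (C : ℝ≥0) : Prop :=
  (∀ t ∈ I, ∫⁻ s in I, ‖k t s‖ₑ ≤ C) ∧ ∀ s ∈ I, ∫⁻ t in I, ‖k t s‖ₑ ≤ C

theorem isBoundedKernel_of_schur (hq : q ≠ ∞) {k : ℝ → ℝ → ℂ} {C : ℝ≥0}
    (hk : Measurable (Function.uncurry k)) (hC : SchurBound k (Ioi 0) C) :
    IsBoundedKernel q k := by
  have hκ : Measurable (Function.uncurry fun t s => ‖k t s‖ₑ) := hk.enorm
  have h1 : ∀ᵐ t ∂halfLine, ∫⁻ s, ‖k t s‖ₑ ∂halfLine ≤ C := by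
    filter_upwards [ae_restrict_mem measurableSet_Ioi] with t ht using hC.1 t ht
  have h2 : ∀ᵐ s ∂halfLine, ∫⁻ t, ‖k t s‖ₑ ∂halfLine ≤ C := by
    filter_upwards [ae_restrict_mem measurableSet_Ioi] with t ht using hC.2 t ht
  have hp := one_le_toReal_of_fact hq
  have hp0 : 0 < q.toReal := by linarith
  have hq0 : q ≠ 0 := (zero_lt_one.trans_le (Fact.out : 1 ≤ q)).ne'
  refine ⟨C, fun u => ?_⟩
  have hmeas : AEStronglyMeasurable (Function.uncurry fun t s => k t s * u s)
      (halfLine.prod halfLine) :=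
    hk.aestronglyMeasurable.mul (Lp.aestronglyMeasurable u).comp_snd
  have hle : eLpNorm (fun t => ∫ s, k t s * u s ∂halfLine) q halfLine ≤ C * eLpNorm u q halfLine := by
    apply eLpNorm_le_of_schur hq hκ h1 h2
    filter_upwards with t
    refine (enorm_integral_le_lintegral_enorm _).trans_eq ?_
    simp_rw [enorm_mul]
  refine ⟨?_, ⟨hmeas.integral_prod_right', hle.trans_lt
    (ENNReal.mul_lt_top ENNReal.coe_lt_top (Lp.eLpNorm_lt_top u))⟩, hle⟩
  -- The Schur test for |k| and |u| gives absolute convergence of the integral for almost every t.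
  have hfin : ∫⁻ t, (∫⁻ s, ‖k t s‖ₑ * ‖u s‖ₑ ∂halfLine) ^ q.toReal ∂halfLine < ∞ := by
    refine (lintegral_lintegral_mul_rpow_le hp hκ
      (Lp.aestronglyMeasurable u).enorm h1 h2).trans_lt ?_
    refine ENNReal.mul_lt_top (ENNReal.rpow_lt_top_of_nonneg hp0.le ENNReal.coe_ne_top) ?_
    exact (eLpNorm_lt_top_iff_lintegral_rpow_enorm_lt_top hq0 hq).1 (Lp.eLpNorm_lt_top u)
  have hm2 : AEMeasurable (fun t => (∫⁻ s, ‖k t s‖ₑ * ‖u s‖ₑ ∂halfLine) ^ q.toReal) halfLine := by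
    refine AEMeasurable.pow_const ?_ _
    have : AEMeasurable (Function.uncurry fun t s => ‖k t s‖ₑ * ‖u s‖ₑ) (halfLine.prod halfLine) :=
      hκ.aemeasurable.mul (Lp.aestronglyMeasurable u).enorm.comp_snd
    exact this.lintegral_prod_right'
  filter_upwards [ae_lt_top' hm2 hfin.ne, hmeas.prodMk_left] with t ht hmt
  refine ⟨hmt, ?_⟩
  rw [ENNReal.rpow_lt_top_iff_of_pos hp0] at ht
  simp only [HasFiniteIntegral, enorm_mul]
  exact ht

/-- Multiplication by the indicator of a set. -/
theorem exists_cut (I : Set ℝ) : ∃ B : LpHalf q →L[ℂ] LpHalf q,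
    MeasurableSet I → ∀ u, B u =ᵐ[halfLine] fun t => I.indicator u t := by
  by_cases hI : MeasurableSet I
  · obtain ⟨B, -, hB⟩ := exists_mul_clm (q := q) (m := I.indicator fun _ => 1) (C := 1)
      ((measurable_const.indicator hI).aestronglyMeasurable)
      (.of_forall fun t => by by_cases h : t ∈ I <;> simp [h])
    refine ⟨B, fun _ u => ?_⟩
    filter_upwards [hB u] with t ht
    rw [ht]
    by_cases h : t ∈ I <;> simp [h]
  -- For a non-measurable set the claim is vacuous, so any operator serves as default.
  · exact ⟨0, fun h => absurd h hI⟩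

/-- Multiplication by the indicator of `I`, as an operator in `L_q(ℝ₊)`. -/
noncomputable def cut (I : Set ℝ) : LpHalf q →L[ℂ] LpHalf q := (exists_cut I).choose

theorem coeFn_cut {I : Set ℝ} (hI : MeasurableSet I) (u : LpHalf q) :
    cut I u =ᵐ[halfLine] fun t => I.indicator u t := (exists_cut I).choose_spec hI u

theorem cut_mul_cut {I J : Set ℝ} (hI : MeasurableSet I) (hJ : MeasurableSet J) :
    (cut I * cut J : LpHalf q →L[ℂ] LpHalf q) = cut (I ∩ J) := by
  ext1 u
  apply Lp.ext
  rw [mul_apply_eq_comp]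
  filter_upwards [coeFn_cut hI (cut J u), coeFn_cut hJ u, coeFn_cut (hI.inter hJ) u]
    with t h1 h2 h3
  rw [h1, h3]
  by_cases h : t ∈ I <;> by_cases h' : t ∈ J <;> simp [h, h', h2]

theorem cut_Ioi_zero : (cut (Ioi 0) : LpHalf q →L[ℂ] LpHalf q) = 1 := by
  ext1 u
  apply Lp.ext
  filter_upwards [coeFn_cut measurableSet_Ioi u, ae_restrict_mem measurableSet_Ioi] with t h1 h2
  rw [h1, indicator_of_mem h2]
  rfl

theorem cut_Ioi_sub {a b : ℝ} (hab : a ≤ b) :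
    (cut (Ioi a) - cut (Ioi b) : LpHalf q →L[ℂ] LpHalf q) = cut (Ioc a b) := by
  ext1 u
  apply Lp.ext
  rw [sub_apply]
  filter_upwards [coeFn_cut (measurableSet_Ioi (a := a)) u, coeFn_cut (measurableSet_Ioi (a := b)) u,
    coeFn_cut (measurableSet_Ioc (a := a) (b := b)) u,
    Lp.coeFn_sub (cut (Ioi a) u) (cut (Ioi b) u)] with t h1 h2 h3 h4
  rw [h4, Pi.sub_apply, h1, h2, h3]
  by_cases h : a < t <;> by_cases h' : b < t
  · simp [h, h', not_le.2 h']
  · simp [h, h', not_lt.1 h']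
  · exact absurd (hab.trans_lt h') h
  · simp [h, h']

theorem norm_cut_le (I : Set ℝ) (hI : MeasurableSet I) :
    ‖(cut I : LpHalf q →L[ℂ] LpHalf q)‖ ≤ 1 := by
  refine opNorm_le_of_eLpNorm_le (C := 1) fun u => ?_
  rw [ENNReal.coe_one, one_mul, eLpNorm_congr_ae (coeFn_cut hI u)]
  exact eLpNorm_indicator_le _

theorem norm_cut_mul_mul_cut_le (hq : q ≠ ∞) {k : ℝ → ℝ → ℂ} {I : Set ℝ} {C : ℝ≥0}
    (hk : Measurable (Function.uncurry k)) (hI : MeasurableSet I) (hI0 : I ⊆ Ioi 0)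
    {B : LpHalf q →L[ℂ] LpHalf q}
    (hB : ∀ u, B u =ᵐ[halfLine] fun t => ∫ s, k t s * u s ∂halfLine)
    (hC : SchurBound k I C) : ‖cut I * B * cut I‖ ≤ C := by
  -- Truncating the kernel to I × I reduces the compression to the Schur test on the half-line.
  set κ : ℝ → ℝ → ℝ≥0∞ := fun t s => I.indicator 1 t * (I.indicator 1 s * ‖k t s‖ₑ) with hκd
  have hκ : Measurable (Function.uncurry κ) := by
    have h1 : Measurable (I.indicator (1 : ℝ → ℝ≥0∞)) := measurable_one.indicator hI
    exact (h1.comp measurable_fst).mul ((h1.comp measurable_snd).mul hk.enorm)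
  have hres : halfLine.restrict I = volume.restrict I := by
    rw [Measure.restrict_restrict hI, inter_eq_left.2 hI0]
  have hint : ∀ f : ℝ → ℝ≥0∞, ∫⁻ s, I.indicator 1 s * f s ∂halfLine = ∫⁻ s in I, f s := by
    intro f
    rw [← hres, ← lintegral_indicator hI]
    apply lintegral_congr
    intro s
    by_cases h : s ∈ I <;> simp [h]
  refine opNorm_le_of_eLpNorm_le fun u => ?_
  refine eLpNorm_le_of_schur hq hκ ?_ ?_ u ?_
  · filter_upwards with t
    by_cases h : t ∈ I
    · simp only [hκd, h, indicator_of_mem, Pi.one_apply, one_mul]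
      rw [hint]
      exact hC.1 t h
    · simp [hκd, h]
  · filter_upwards with s
    by_cases h : s ∈ I
    · simp only [hκd, h, indicator_of_mem, Pi.one_apply, one_mul]
      rw [hint]
      exact hC.2 s h
    · simp [hκd, h]
  · rw [mul_apply_eq_comp, mul_apply_eq_comp]
    filter_upwards [coeFn_cut hI (B (cut I u)), hB (cut I u)] with t h1 h2
    rw [h1]
    by_cases h : t ∈ I
    · rw [indicator_of_mem h, h2]
      refine (enorm_integral_le_lintegral_enorm _).trans (lintegral_mono_ae ?_)
      filter_upwards [coeFn_cut hI u] with s hs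
      rw [hs]
      by_cases h' : s ∈ I <;> simp [hκd, h, h', enorm_mul]
    · simp [h]

/-! ### Triangular operators. -/

/-- `(B u)|_{(a, ∞)}` depends on `u|_{(a, ∞)}` only, for all `a` in `A`. -/
def IsTriangular (A : Set ℝ) (B : LpHalf q →L[ℂ] LpHalf q) : Prop :=
  ∀ a ∈ A, cut (Ioi a) * B * cut (Ioi a) = cut (Ioi a) * B

theorem IsTriangular.add {A : Set ℝ} {B B' : LpHalf q →L[ℂ] LpHalf q} (h : IsTriangular A B)
    (h' : IsTriangular A B') : IsTriangular A (B + B') := by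
  intro a ha
  rw [mul_add, add_mul, h a ha, h' a ha]

theorem IsTriangular.smul {A : Set ℝ} {B : LpHalf q →L[ℂ] LpHalf q} (h : IsTriangular A B)
    (c : ℂ) : IsTriangular A (c • B) := by
  intro a ha
  rw [mul_smul_comm, smul_mul_assoc, h a ha]

theorem IsTriangular.mul {A : Set ℝ} {B B' : LpHalf q →L[ℂ] LpHalf q} (h : IsTriangular A B)
    (h' : IsTriangular A B') : IsTriangular A (B * B') := by
  intro a ha
  rw [← mul_assoc, ← h a ha, mul_assoc _ (cut (Ioi a)) B', mul_assoc _ (cut (Ioi a) * B'), h' a ha]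

theorem isTriangular_of_mul {A : Set ℝ} {B : LpHalf q →L[ℂ] LpHalf q} {m : ℝ → ℂ}
    (hB : ∀ u, B u =ᵐ[halfLine] fun t => m t * u t) : IsTriangular A B := by
  intro a _
  ext1 u
  apply Lp.ext
  simp only [mul_apply_eq_comp]
  filter_upwards [coeFn_cut measurableSet_Ioi (B (cut (Ioi a) u)), coeFn_cut measurableSet_Ioi (B u),
    hB u, hB (cut (Ioi a) u), coeFn_cut (measurableSet_Ioi (a := a)) u] with t h1 h2 h3 h4 h5
  rw [h1, h2]
  by_cases h : t ∈ Ioi a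
  · rw [indicator_of_mem h, indicator_of_mem h, h3, h4, h5, indicator_of_mem h]
  · simp [indicator_of_notMem h]

theorem isTriangular_of_kernel {A : Set ℝ} {B : LpHalf q →L[ℂ] LpHalf q} {k : ℝ → ℝ → ℂ}
    (hB : ∀ u, B u =ᵐ[halfLine] fun t => ∫ s, k t s * u s ∂halfLine)
    (hk : ∀ a ∈ A, ∀ᵐ t ∂halfLine, ∀ᵐ s ∂halfLine, a < t → s ≤ a → k t s = 0) :
    IsTriangular A B := by
  intro a ha
  ext1 u
  apply Lp.ext
  simp only [mul_apply_eq_comp]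
  filter_upwards [coeFn_cut measurableSet_Ioi (B (cut (Ioi a) u)), coeFn_cut measurableSet_Ioi (B u),
    hB u, hB (cut (Ioi a) u), hk a ha] with t h1 h2 h3 h4 h5
  rw [h1, h2]
  by_cases h : t ∈ Ioi a
  · rw [indicator_of_mem h, indicator_of_mem h, h3, h4]
    apply integral_congr_ae
    filter_upwards [h5, coeFn_cut (measurableSet_Ioi (a := a)) u] with s hs hs'
    rw [hs']
    by_cases h' : s ∈ Ioi a
    · rw [indicator_of_mem h']
    · rw [hs h (not_lt.1 h'), zero_mul, zero_mul]
  · simp [indicator_of_notMem h]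

/-- The algebraic core of both halves of the argument: invertibility of `1 + Q₁ G₁ + Q₂ G₂` for
triangular bounded `Q₁`, `Q₂` and triangular integral operators `G₁`, `G₂`. -/
theorem isUnit_one_add_of_isTriangular {T C : ℝ} (hT : 0 ≤ T)
    {Q₁ Q₂ G₁ G₂ : LpHalf q →L[ℂ] LpHalf q} (hQ₁ : IsTriangular (Icc 0 T) Q₁)
    (hQ₂ : IsTriangular (Icc 0 T) Q₂) (hG₁ : IsTriangular (Icc 0 T) G₁)
    (hG₂ : IsTriangular (Icc 0 T) G₂)
    (htail : ‖cut (Ioi T) * (Q₁ * G₁ + Q₂ * G₂) * cut (Ioi T)‖ < 1)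
    (hl₁ : ∀ a b, 0 ≤ a → a ≤ b → b ≤ T → ‖cut (Ioc a b) * G₁ * cut (Ioc a b)‖ ≤ C * (b - a))
    (hl₂ : ∀ a b, 0 ≤ a → a ≤ b → b ≤ T → ‖cut (Ioc a b) * G₂ * cut (Ioc a b)‖ ≤ C * (b - a)) :
    IsUnit (1 + (Q₁ * G₁ + Q₂ * G₂)) := by
  -- Triangularity of Q discards the values on (0, a], and that of G keeps data on (a, b] from
  -- reaching (b, ∞). So the block of Q G factors through the block of G, and Q need only be
  -- bounded.
  have hblock : ∀ (Q G : LpHalf q →L[ℂ] LpHalf q), IsTriangular (Icc 0 T) Q →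
      IsTriangular (Icc 0 T) G → ∀ a b, 0 ≤ a → a ≤ b → b ≤ T →
      cut (Ioc a b) * (Q * G) * cut (Ioc a b)
        = cut (Ioc a b) * Q * (cut (Ioc a b) * G * cut (Ioc a b)) := by
    intro Q G hQ hG a b ha hab hb
    have hQa := hQ a ⟨ha, hab.trans hb⟩
    have hGb := hG b ⟨ha.trans hab, hb⟩
    have e1 : (cut (Ioc a b) * cut (Ioi a) : LpHalf q →L[ℂ] LpHalf q) = cut (Ioc a b) := by
      rw [cut_mul_cut measurableSet_Ioc measurableSet_Ioi]
      congr 1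
      exact inter_eq_left.2 Ioc_subset_Ioi_self
    have e2 : (cut (Ioi b) * cut (Ioc a b) : LpHalf q →L[ℂ] LpHalf q) = cut ∅ := by
      rw [cut_mul_cut measurableSet_Ioi measurableSet_Ioc]
      congr 1
      ext t
      simp only [mem_inter_iff, mem_Ioi, mem_Ioc, mem_empty_iff_false, iff_false]
      intro h
      linarith [h.1, h.2.2]
    have e3 : (cut ∅ : LpHalf q →L[ℂ] LpHalf q) = 0 := by
      rw [← Ioc_self (0 : ℝ), ← cut_Ioi_sub le_rfl, sub_self]
    have e4 : cut (Ioi b) * G * cut (Ioc a b) = 0 := by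
      rw [← hGb, mul_assoc, e2, e3, mul_zero]
    have e5 : cut (Ioi a) * G * cut (Ioc a b) = cut (Ioc a b) * G * cut (Ioc a b) := by
      rw [← cut_Ioi_sub (q := q) hab, sub_mul, sub_mul, cut_Ioi_sub hab, e4, sub_zero]
    have e6 : cut (Ioc a b) * Q * cut (Ioi a) = cut (Ioc a b) * Q := by
      rw [← e1, mul_assoc, mul_assoc, ← mul_assoc (cut (Ioi a)), hQa, ← mul_assoc]
    calc cut (Ioc a b) * (Q * G) * cut (Ioc a b)
        = cut (Ioc a b) * Q * G * cut (Ioc a b) := by noncomm_ring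
      _ = cut (Ioc a b) * Q * cut (Ioi a) * G * cut (Ioc a b) := by rw [e6]
      _ = cut (Ioc a b) * Q * (cut (Ioi a) * G * cut (Ioc a b)) := by simp only [mul_assoc]
      _ = _ := by rw [e5]
  have hnorm : ∀ (Q G : LpHalf q →L[ℂ] LpHalf q), IsTriangular (Icc 0 T) Q →
      IsTriangular (Icc 0 T) G →
      (∀ a b, 0 ≤ a → a ≤ b → b ≤ T → ‖cut (Ioc a b) * G * cut (Ioc a b)‖ ≤ C * (b - a)) →
      ∀ a b, 0 ≤ a → a ≤ b → b ≤ T →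
      ‖cut (Ioc a b) * (Q * G) * cut (Ioc a b)‖ ≤ ‖Q‖ * (C * (b - a)) := by
    intro Q G hQ hG hl a b ha hab hb
    rw [hblock Q G hQ hG a b ha hab hb]
    refine (norm_mul_le _ _).trans ?_
    gcongr
    · refine (norm_mul_le _ _).trans ?_
      exact mul_le_of_le_one_left (norm_nonneg _) (norm_cut_le _ measurableSet_Ioc)
    · exact hl a b ha hab hb
  refine isUnit_one_add_of_triangular (p := fun a => cut (Ioi a)) (T := T)
    (C := ‖Q₁‖ * C + ‖Q₂‖ * C) hT cut_Ioi_zero ?_ ?_ htail ?_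
  · intro a b _ hab _
    simp only [cut_mul_cut measurableSet_Ioi measurableSet_Ioi, Ioi_inter_Ioi]
    simp [hab]
  · intro a ha haT
    exact ((hQ₁.mul hG₁).add (hQ₂.mul hG₂)) a ⟨ha, haT⟩
  · intro a b ha hab hb
    simp only [cut_Ioi_sub hab]
    rw [mul_add, add_mul]
    refine (norm_add_le _ _).trans ((add_le_add (hnorm Q₁ G₁ hQ₁ hG₁ hl₁ a b ha hab hb)
      (hnorm Q₂ G₂ hQ₂ hG₂ hl₂ a b ha hab hb)).trans_eq ?_)
    ring

end Operators

/-! ### Local absolute continuity and primitives on the half-line. -/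

theorem absolutelyContinuousOnInterval_congr {X : Type*} [PseudoMetricSpace X] {f g : ℝ → X}
    {a b : ℝ} (hf : AbsolutelyContinuousOnInterval f a b) (h : EqOn f g (uIcc a b)) :
    AbsolutelyContinuousOnInterval g a b := by
  rw [absolutelyContinuousOnInterval_iff] at hf ⊢
  intro ε hε
  obtain ⟨η, hη, H⟩ := hf ε hε
  refine ⟨η, hη, fun E hE hl => ?_⟩
  rw [← Finset.sum_congr rfl fun i hi => ?_]
  · exact H E hE hl
  · rw [h (hE.1 i hi).1, h (hE.1 i hi).2]

theorem absolutelyContinuousOnInterval_ofReal {f : ℝ → ℝ} {a b : ℝ}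
    (hf : AbsolutelyContinuousOnInterval f a b) :
    AbsolutelyContinuousOnInterval (fun t => (f t : ℂ)) a b := by
  rw [absolutelyContinuousOnInterval_iff] at hf ⊢
  simpa only [Complex.isometry_ofReal.dist_eq] using hf

theorem absolutelyContinuousOnInterval_const {X : Type*} [PseudoMetricSpace X] (c : X) (a b : ℝ) :
    AbsolutelyContinuousOnInterval (fun _ => c) a b := by
  rw [absolutelyContinuousOnInterval_iff]
  intro ε hε
  exact ⟨1, one_pos, fun E _ _ => by simpa using hε⟩

theorem absolutelyContinuousOnInterval_integral {f : ℝ → ℂ} {a b : ℝ}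
    (hf : IntervalIntegrable f volume a b) :
    AbsolutelyContinuousOnInterval (fun t => ∫ s in a..t, f s) a b := by
  have hre : IntervalIntegrable (fun s => (f s).re) volume a b :=
    ⟨hf.1.re, hf.2.re⟩
  have him : IntervalIntegrable (fun s => (f s).im) volume a b :=
    ⟨hf.1.im, hf.2.im⟩
  have h1 := absolutelyContinuousOnInterval_ofReal
    (hre.absolutelyContinuousOnInterval_intervalIntegral left_mem_uIcc)
  have h2 := (absolutelyContinuousOnInterval_ofReal
    (him.absolutelyContinuousOnInterval_intervalIntegral left_mem_uIcc)).const_smul Complex.I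
  refine absolutelyContinuousOnInterval_congr (h1.fun_add h2) fun t ht => ?_
  have ht' : IntervalIntegrable f volume a t := hf.mono_set (uIcc_subset_uIcc_left ht)
  have hre' : IntervalIntegrable (fun s => ((f s).re : ℂ)) volume a t :=
    ⟨ht'.1.re.ofReal, ht'.2.re.ofReal⟩
  have him' : IntervalIntegrable (fun s => ((f s).im : ℂ)) volume a t :=
    ⟨ht'.1.im.ofReal, ht'.2.im.ofReal⟩
  have him'' : IntervalIntegrable (fun s => Complex.I • ((f s).im : ℂ)) volume a t := him'.const_mul _
  rw [← intervalIntegral.integral_ofReal, ← intervalIntegral.integral_ofReal,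
    ← intervalIntegral.integral_smul, ← intervalIntegral.integral_add hre' him'']
  apply intervalIntegral.integral_congr
  intro s _
  simp only [smul_eq_mul]
  rw [mul_comm, Complex.re_add_im]

/-- Absolute continuity on all bounded intervals of the positive semi-axis. -/
def LocAC (f : ℝ → ℂ) : Prop := ∀ b : ℝ, 0 < b → AbsolutelyContinuousOnInterval f 0 b

theorem LocAC.add {f g : ℝ → ℂ} (hf : LocAC f) (hg : LocAC g) : LocAC fun t => f t + g t :=
  fun b hb => (hf b hb).fun_add (hg b hb)

theorem LocAC.sub {f g : ℝ → ℂ} (hf : LocAC f) (hg : LocAC g) : LocAC fun t => f t - g t :=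
  fun b hb => (hf b hb).fun_sub (hg b hb)

theorem LocAC.mul {f g : ℝ → ℂ} (hf : LocAC f) (hg : LocAC g) : LocAC fun t => f t * g t :=
  fun b hb => (hf b hb).fun_smul (hg b hb)

theorem LocAC.const_mul {f : ℝ → ℂ} (hf : LocAC f) (c : ℂ) : LocAC fun t => c * f t :=
  fun b hb => (hf b hb).const_smul c

/-- Local integrability on the closed half-line. -/
def LocInt (f : ℝ → ℂ) : Prop := ∀ b : ℝ, 0 < b → IntervalIntegrable f volume 0 b

theorem LocInt.intervalIntegrable {f : ℝ → ℂ} (hf : LocInt f) {a b : ℝ} (ha : 0 ≤ a)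
    (hb : 0 ≤ b) : IntervalIntegrable f volume a b := by
  have h : ∀ c, 0 ≤ c → IntervalIntegrable f volume 0 c := by
    intro c hc
    rcases hc.eq_or_lt with rfl | hc
    · exact IntervalIntegrable.refl
    · exact hf c hc
  exact (h a ha).symm.trans (h b hb)

theorem LocInt.mul_continuous {f g : ℝ → ℂ} (hf : LocInt f) (hg : Continuous g) :
    LocInt fun t => f t * g t :=
  fun b hb => (hf b hb).mul_continuousOn hg.continuousOn

theorem locInt_of_continuous {f : ℝ → ℂ} (hf : Continuous f) : LocInt f :=
  fun b _ => hf.intervalIntegrable 0 b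

theorem locAC_of_integral {f F : ℝ → ℂ} (hf : LocInt f)
    (hF : ∀ t, 0 ≤ t → F t = F 0 + ∫ s in (0 : ℝ)..t, f s) :
    LocAC F ∧ ∀ᵐ t ∂halfLine, HasDerivAt F (f t) t := by
  constructor
  · intro b hb
    refine absolutelyContinuousOnInterval_congr
      ((absolutelyContinuousOnInterval_const (F 0) 0 b).fun_add
        (absolutelyContinuousOnInterval_integral (hf b hb))) fun t ht => ?_
    rw [uIcc_of_le hb.le] at ht
    exact (hF t ht.1).symm
  · rw [ae_restrict_iff' measurableSet_Ioi]
    -- Lebesgue differentiation on each [0, n + 1]; the countably many null sets are discarded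
    -- together.
    have h : ∀ n : ℕ, ∀ᵐ x, x ∈ uIcc 0 ((n : ℝ) + 1) → ∀ c ∈ uIcc 0 ((n : ℝ) + 1),
        HasDerivAt (fun x => ∫ t in c..x, f t) (f x) x := fun n =>
      (hf (n + 1) (by positivity)).ae_hasDerivAt_integral
    filter_upwards [ae_all_iff.2 h] with t ht ht0
    have ht0' : (0 : ℝ) < t := ht0
    obtain ⟨n, hn⟩ := exists_nat_gt t
    have hn' : (0 : ℝ) ≤ n + 1 := by positivity
    have := ht n (by rw [uIcc_of_le hn']; exact ⟨ht0'.le, by linarith⟩) 0 left_mem_uIcc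
    refine (this.const_add (F 0)).congr_of_eventuallyEq ?_
    filter_upwards [Ioi_mem_nhds ht0'] with s hs
    exact hF s (le_of_lt hs)

theorem LocAC.eq_of_deriv_zero {f : ℝ → ℂ} (hf : LocAC f)
    (h : ∀ᵐ t ∂halfLine, HasDerivAt f 0 t) {t : ℝ} (ht : 0 ≤ t) : f t = f 0 := by
  rcases ht.eq_or_lt with rfl | ht
  · rfl
  have h' : ∀ᵐ x, x ∈ uIcc 0 t → HasDerivAt f 0 x := by
    rw [ae_restrict_iff' measurableSet_Ioi] at h
    filter_upwards [h, Measure.ae_ne volume (0 : ℝ)] with x hx hx0 hxt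
    rw [uIcc_of_le ht.le] at hxt
    exact hx (lt_of_le_of_ne hxt.1 hx0.symm)
  obtain ⟨C, hC⟩ := (hf t ht).const_of_ae_hasDerivAt_zero h'
  rw [hC t right_mem_uIcc, hC 0 left_mem_uIcc]

/-! ### Solutions, Wronskians and fundamental pairs. -/

/-- `u'' = W u + g` on the half-line, with `v = u'`. -/
structure IsSol (W g u v : ℝ → ℂ) : Prop where
  ac : LocAC u
  ac' : LocAC v
  deriv : ∀ᵐ t ∂halfLine, HasDerivAt u (v t) t
  deriv' : ∀ᵐ t ∂halfLine, HasDerivAt v (W t * u t + g t) t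

/-- `u'' = W u` on the closed half-line in integral form, with `v = u'`. -/
structure IsHomSol (W u v : ℝ → ℂ) : Prop where
  cont : Continuous u
  cont' : Continuous v
  eq : ∀ t, 0 ≤ t → u t = u 0 + ∫ s in (0 : ℝ)..t, v s
  eq' : ∀ t, 0 ≤ t → v t = v 0 + ∫ s in (0 : ℝ)..t, W s * u s

theorem IsHomSol.isSol {W u v : ℝ → ℂ} (hW : LocInt W) (h : IsHomSol W u v) :
    IsSol W (fun _ => 0) u v := by
  have h1 := locAC_of_integral (locInt_of_continuous h.cont') h.eq
  have h2 := locAC_of_integral (hW.mul_continuous h.cont) h.eq'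
  exact ⟨h1.1, h2.1, h1.2, by simpa using h2.2⟩

theorem IsHomSol.add {W u v u' v' : ℝ → ℂ} (hW : LocInt W) (h : IsHomSol W u v)
    (h' : IsHomSol W u' v') : IsHomSol W (fun t => u t + u' t) (fun t => v t + v' t) := by
  refine ⟨h.cont.add h'.cont, h.cont'.add h'.cont', fun t ht => ?_, fun t ht => ?_⟩
  · rw [h.eq t ht, h'.eq t ht, intervalIntegral.integral_add (h.cont'.intervalIntegrable _ _)
      (h'.cont'.intervalIntegrable _ _)]
    ring
  · simp_rw [mul_add]
    rw [h.eq' t ht, h'.eq' t ht, intervalIntegral.integral_add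
      ((hW.mul_continuous h.cont).intervalIntegrable le_rfl ht)
      ((hW.mul_continuous h'.cont).intervalIntegrable le_rfl ht)]
    ring

theorem IsHomSol.const_mul {W u v : ℝ → ℂ} (h : IsHomSol W u v) (c : ℂ) :
    IsHomSol W (fun t => c * u t) (fun t => c * v t) := by
  refine ⟨h.cont.const_mul c, h.cont'.const_mul c, fun t ht => ?_, fun t ht => ?_⟩
  · rw [h.eq t ht, intervalIntegral.integral_const_mul, mul_add]
  · simp_rw [mul_left_comm (W _) c]
    rw [h.eq' t ht, intervalIntegral.integral_const_mul, mul_add]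

/-- By periodicity of W a translate by one period is again a solution; the integral over [0, 1] is
absorbed into the initial value. -/
theorem IsHomSol.shift {W u v : ℝ → ℂ} (hW : LocInt W) (hper : ∀ t, W (t + 1) = W t)
    (h : IsHomSol W u v) : IsHomSol W (fun t => u (t + 1)) (fun t => v (t + 1)) := by
  have key : ∀ {f F : ℝ → ℂ}, LocInt f → (∀ t, 0 ≤ t → F t = F 0 + ∫ s in (0 : ℝ)..t, f s) →
      ∀ t, 0 ≤ t → F (t + 1) = F (0 + 1) + ∫ s in (0 : ℝ)..t, f (s + 1) := by
    intro f F hf hF t ht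
    rw [hF (t + 1) (by linarith), hF (0 + 1) (by norm_num),
      intervalIntegral.integral_comp_add_right (fun s => f s), add_assoc,
      intervalIntegral.integral_add_adjacent_intervals
        (hf.intervalIntegrable le_rfl (by norm_num))
        (hf.intervalIntegrable (by norm_num) (by linarith))]
  refine ⟨by have := h.cont; fun_prop, by have := h.cont'; fun_prop,
    key (locInt_of_continuous h.cont') h.eq, fun t ht => ?_⟩
  rw [key (hW.mul_continuous h.cont) h.eq' t ht]
  simp_rw [hper]

/-- The terms with φ' v and W φ u cancel. This yields both constancy of the homogeneous Wronskian
and variation of constants. -/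
theorem IsSol.wronskian {W g u v φ φ' : ℝ → ℂ} (h : IsSol W g u v)
    (hφ : IsSol W (fun _ => 0) φ φ') :
    LocAC (fun t => φ t * v t - φ' t * u t) ∧
      ∀ᵐ t ∂halfLine, HasDerivAt (fun t => φ t * v t - φ' t * u t) (φ t * g t) t := by
  refine ⟨(hφ.ac.mul h.ac').sub (hφ.ac'.mul h.ac), ?_⟩
  filter_upwards [h.deriv, h.deriv', hφ.deriv, hφ.deriv'] with t h1 h2 h3 h4
  refine ((h3.mul h2).sub (h4.mul h1)).congr_deriv ?_
  ring

theorem IsHomSol.wronskian_eq {W φ φ' ψ ψ' : ℝ → ℂ} (hW : LocInt W) (hφ : IsHomSol W φ φ')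
    (hψ : IsHomSol W ψ ψ') {t : ℝ} (ht : 0 ≤ t) :
    φ t * ψ' t - φ' t * ψ t = φ 0 * ψ' 0 - φ' 0 * ψ 0 := by
  obtain ⟨h1, h2⟩ := (hψ.isSol hW).wronskian (hφ.isSol hW)
  simp only [mul_zero] at h2
  exact h1.eq_of_deriv_zero h2 ht

/-- A pair of solutions with Wronskian `1`. -/
structure IsFundPair (W φ φ' ψ ψ' : ℝ → ℂ) : Prop where
  left : IsHomSol W φ φ'
  right : IsHomSol W ψ ψ'
  wr : ∀ t, 0 ≤ t → φ t * ψ' t - φ' t * ψ t = 1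

theorem isFundPair_of {W φ φ' ψ ψ' : ℝ → ℂ} (hW : LocInt W) (hφ : IsHomSol W φ φ')
    (hψ : IsHomSol W ψ ψ') (h0 : φ 0 * ψ' 0 - φ' 0 * ψ 0 = 1) : IsFundPair W φ φ' ψ ψ' :=
  ⟨hφ, hψ, fun t ht => by rw [hφ.wronskian_eq hW hψ ht, h0]⟩

/-- Cramer's rule: the coefficients are Wronskians with u, which are constant in t. -/
theorem IsFundPair.repr {W φ φ' ψ ψ' : ℝ → ℂ} (hW : LocInt W) (h : IsFundPair W φ φ' ψ ψ')
    {u v : ℝ → ℂ} (hu : IsHomSol W u v) {t : ℝ} (ht : 0 ≤ t) :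
    u t = (u 0 * ψ' 0 - v 0 * ψ 0) * φ t + (φ 0 * v 0 - φ' 0 * u 0) * ψ t ∧
    v t = (u 0 * ψ' 0 - v 0 * ψ 0) * φ' t + (φ 0 * v 0 - φ' 0 * u 0) * ψ' t := by
  rw [← h.left.wronskian_eq hW hu ht, ← hu.wronskian_eq hW h.right ht]
  have := h.wr t ht
  constructor
  · linear_combination (-u t) * this
  · linear_combination (-v t) * this

/-! ### Existence of solutions with a bounded measurable coefficient. -/

theorem integral_exp_mul_le {L : ℝ} (hL : 0 < L) (t : ℝ) :
    ∫ s in (0 : ℝ)..t, Real.exp (L * s) ≤ Real.exp (L * t) / L := by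
  rw [intervalIntegral.integral_comp_mul_left (fun s => Real.exp s) hL.ne', integral_exp,
    mul_zero, Real.exp_zero, smul_eq_mul, div_eq_inv_mul]
  gcongr
  linarith

open scoped BoundedContinuousFunction in
/-- Existence for linear Carathéodory systems `Y' = A Y` with a bounded coefficient. -/
theorem exists_solution_linear_system {E : Type*} [NormedAddCommGroup E] [NormedSpace ℝ E]
    [CompleteSpace E] {A : ℝ → E →L[ℝ] E} {L : ℝ} (hL : 0 < L)
    (hA : ∀ Z : ℝ → E, Continuous Z → AEStronglyMeasurable (fun t => A t (Z t)) volume)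
    (hAL : ∀ᵐ t, ‖A t‖ ≤ L) (v : E) :
    ∃ Y : ℝ → E, Continuous Y ∧ Y 0 = v ∧ ∀ t, 0 ≤ t → Y t = v + ∫ s in (0 : ℝ)..t, A s (Y s) := by
  -- In the unknown Z(t) = exp(-lam t) Y(t) the Picard map contracts by L / lam = 1/2 on bounded
  -- continuous functions, so one fixed point covers the whole half-line.
  obtain ⟨lam, hlam⟩ : ∃ lam : ℝ, lam = 2 * L := ⟨_, rfl⟩
  have hlam0 : 0 < lam := by rw [hlam]; positivity
  have hint : ∀ Z : ℝ → E, Continuous Z → ∀ a b,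
      IntervalIntegrable (fun s => A s (Z s)) volume a b := by
    intro Z hZ a b
    refine ((hZ.norm.const_mul L).intervalIntegrable a b).mono_fun (hA Z hZ).restrict ?_
    refine ae_restrict_of_ae ?_
    filter_upwards [hAL] with s hs
    rw [Real.norm_of_nonneg (by positivity)]
    exact (A s).le_of_opNorm_le hs _
  -- `max t 0` freezes the map for negative t, so that it acts on functions on all of ℝ.
  let F : (ℝ → E) → ℝ → E := fun Z t => Real.exp (-(lam * max t 0)) •
    (v + ∫ s in (0 : ℝ)..max t 0, A s (Real.exp (lam * s) • Z s))
  have hFc : ∀ Z : ℝ → E, Continuous Z → Continuous (F Z) := by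
    intro Z hZ
    have h1 : Continuous fun s => Real.exp (lam * s) • Z s := by fun_prop
    have h2 := intervalIntegral.continuous_primitive (hint _ h1) 0
    have h3 : Continuous fun t => ∫ s in (0 : ℝ)..max t 0, A s (Real.exp (lam * s) • Z s) :=
      h2.comp (by fun_prop : Continuous fun t : ℝ => max t 0)
    exact Continuous.smul (by fun_prop) (continuous_const.add h3)
  have hbd : ∀ (Z : ℝ → E) (M : ℝ), Continuous Z → (∀ s, ‖Z s‖ ≤ M) → ∀ t,
      ‖Real.exp (-(lam * max t 0)) • ∫ s in (0 : ℝ)..max t 0, A s (Real.exp (lam * s) • Z s)‖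
        ≤ M / 2 := by
    intro Z M hZ hM t
    have hM0 : 0 ≤ M := (norm_nonneg _).trans (hM 0)
    have h1 : ‖∫ s in (0 : ℝ)..max t 0, A s (Real.exp (lam * s) • Z s)‖
        ≤ ∫ s in (0 : ℝ)..max t 0, L * M * Real.exp (lam * s) := by
      refine intervalIntegral.norm_integral_le_of_norm_le (le_max_right _ _) ?_
        ((by fun_prop : Continuous fun s => L * M * Real.exp (lam * s)).intervalIntegrable _ _)
      filter_upwards [hAL] with s hs _
      refine ((A s).le_of_opNorm_le hs _).trans ?_
      rw [norm_smul, Real.norm_of_nonneg (Real.exp_pos _).le]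
      calc L * (Real.exp (lam * s) * ‖Z s‖) ≤ L * (Real.exp (lam * s) * M) := by gcongr; exact hM s
        _ = _ := by ring
    rw [intervalIntegral.integral_const_mul] at h1
    have h2 := h1.trans (mul_le_mul_of_nonneg_left (integral_exp_mul_le hlam0 (max t 0))
      (by positivity))
    rw [norm_smul, Real.norm_of_nonneg (Real.exp_pos _).le, Real.exp_neg]
    calc _ ≤ (Real.exp (lam * max t 0))⁻¹ * (L * M * (Real.exp (lam * max t 0) / lam)) := by gcongr
      _ = M / 2 := by
        have := (Real.exp_pos (lam * max t 0)).ne'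
        rw [hlam]
        rw [hlam] at this
        field_simp
  have hexp1 : ∀ t : ℝ, Real.exp (-(lam * max t 0)) ≤ 1 := by
    intro t
    rw [Real.exp_le_one_iff]
    have := mul_nonneg hlam0.le (le_max_right t 0)
    linarith
  let Φ : (ℝ →ᵇ E) → (ℝ →ᵇ E) := fun Z =>
    BoundedContinuousFunction.ofNormedAddCommGroup (F Z) (hFc Z Z.continuous) (‖v‖ + ‖Z‖ / 2) <| by
      intro t
      simp only [F, smul_add]
      refine (norm_add_le _ _).trans (add_le_add ?_ (hbd Z ‖Z‖ Z.continuous Z.norm_coe_le_norm t))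
      rw [norm_smul, Real.norm_of_nonneg (Real.exp_pos _).le]
      exact mul_le_of_le_one_left (norm_nonneg _) (hexp1 t)
  have hΦ : ContractingWith (1 / 2) Φ := by
    refine ⟨by norm_num, LipschitzWith.of_dist_le_mul fun Z Z' => ?_⟩
    rw [BoundedContinuousFunction.dist_le (by positivity)]
    intro t
    have hZ : Continuous fun s => Real.exp (lam * s) • Z s := by fun_prop
    have hZ' : Continuous fun s => Real.exp (lam * s) • Z' s := by fun_prop
    have e : F Z t - F Z' t = Real.exp (-(lam * max t 0)) •
        ∫ s in (0 : ℝ)..max t 0, A s (Real.exp (lam * s) • (Z s - Z' s)) := by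
      simp only [F]
      rw [← smul_sub, add_sub_add_left_eq_sub, ← intervalIntegral.integral_sub (hint _ hZ _ _)
        (hint _ hZ' _ _)]
      simp only [smul_sub, map_sub]
    change dist (F Z t) (F Z' t) ≤ _
    rw [dist_eq_norm, e]
    refine (hbd (fun s => Z s - Z' s) (dist Z Z') (Z.continuous.sub Z'.continuous) (fun s => ?_)
      t).trans_eq ?_
    · rw [← dist_eq_norm]
      exact BoundedContinuousFunction.dist_coe_le_dist s
    · push_cast
      ring
  have hfix := hΦ.fixedPoint_isFixedPt
  set Z : ℝ →ᵇ E := ContractingWith.fixedPoint Φ hΦ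
  have hZ : ∀ t, Z t = F Z t := by
    intro t
    conv_lhs => rw [← hfix]
    rfl
  have hval : ∀ t, 0 ≤ t → Real.exp (lam * t) • Z t
      = v + ∫ s in (0 : ℝ)..t, A s (Real.exp (lam * s) • Z s) := by
    intro t ht
    conv_lhs => rw [hZ t]
    simp only [F]
    rw [max_eq_left ht, smul_smul, ← Real.exp_add, add_neg_cancel, Real.exp_zero, one_smul]
  refine ⟨fun t => Real.exp (lam * t) • Z t, by fun_prop, ?_, hval⟩
  simpa using hval 0 le_rfl

theorem exists_isHomSol {W : ℝ → ℂ} {L : ℝ} (hW : AEStronglyMeasurable W volume)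
    (hL : ∀ᵐ t, ‖W t‖ ≤ L) (α β : ℂ) :
    ∃ u v, IsHomSol W u v ∧ u 0 = α ∧ v 0 = β := by
  let A : ℝ → ℂ × ℂ →L[ℝ] ℂ × ℂ := fun t =>
    (ContinuousLinearMap.snd ℝ ℂ ℂ).prod (W t • ContinuousLinearMap.fst ℝ ℂ ℂ)
  have hAv : ∀ t Z, A t Z = (Z.2, W t * Z.1) := fun t Z => rfl
  have hA : ∀ Z : ℝ → ℂ × ℂ, Continuous Z → AEStronglyMeasurable (fun t => A t (Z t)) volume := by
    intro Z hZ
    simp only [hAv]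
    exact hZ.snd.aestronglyMeasurable.prodMk (hW.mul hZ.fst.aestronglyMeasurable)
  have hAL : ∀ᵐ t, ‖A t‖ ≤ max L 1 := by
    filter_upwards [hL] with t ht
    refine ContinuousLinearMap.opNorm_le_bound _ (by positivity) fun Z => ?_
    rw [hAv, Prod.norm_mk]
    refine max_le ?_ ?_
    · exact (norm_snd_le Z).trans (le_mul_of_one_le_left (norm_nonneg _) (le_max_right _ _))
    · rw [norm_mul]
      exact mul_le_mul (ht.trans (le_max_left _ _)) (norm_fst_le Z) (norm_nonneg _) (by positivity)
  obtain ⟨Y, hYc, hY0, hY⟩ := exists_solution_linear_system (by positivity) hA hAL (α, β)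
  have hint : ∀ t, 0 ≤ t → IntervalIntegrable (fun s => A s (Y s)) volume 0 t := by
    intro t _
    refine ((hYc.norm.const_mul (max L 1)).intervalIntegrable 0 t).mono_fun (hA Y hYc).restrict ?_
    refine ae_restrict_of_ae ?_
    filter_upwards [hAL] with s hs
    rw [Real.norm_of_nonneg (by positivity)]
    exact (A s).le_of_opNorm_le hs _
  refine ⟨fun t => (Y t).1, fun t => (Y t).2, ⟨hYc.fst, hYc.snd, fun t ht => ?_, fun t ht => ?_⟩,
    congrArg Prod.fst hY0, congrArg Prod.snd hY0⟩
  · have := congrArg (ContinuousLinearMap.fst ℝ ℂ ℂ) (hY t ht)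
    rw [map_add, ← ContinuousLinearMap.intervalIntegral_comp_comm _ (hint t ht)] at this
    rw [hY0]
    exact this
  · have := congrArg (ContinuousLinearMap.snd ℝ ℂ ℂ) (hY t ht)
    rw [map_add, ← ContinuousLinearMap.intervalIntegral_comp_comm _ (hint t ht)] at this
    rw [hY0]
    exact this

/-! ### Growth and decay of functions satisfying a periodic recurrence. -/

theorem exists_add_natCast_eq {t : ℝ} (ht : 0 ≤ t) : ∃ a ∈ Icc (0 : ℝ) 1, ∃ n : ℕ, t = a + n := by
  refine ⟨t - ⌊t⌋₊, ⟨?_, ?_⟩, ⌊t⌋₊, by ring⟩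
  · linarith [Nat.floor_le ht]
  · linarith [Nat.lt_floor_add_one t]

theorem exists_bound_Icc {f : ℝ → ℂ} (hf : Continuous f) (a b : ℝ) :
    ∃ C, 0 ≤ C ∧ ∀ t ∈ Icc a b, ‖f t‖ ≤ C := by
  obtain ⟨C, hC⟩ := isCompact_Icc.exists_bound_of_continuousOn (s := Icc a b) hf.continuousOn
  exact ⟨max C 0, le_max_right _ _, fun t ht => (hC t ht).trans (le_max_left _ _)⟩

theorem norm_add_natCast_eq {f : ℝ → ℂ} (h : ∀ t, 0 ≤ t → ‖f (t + 1)‖ = ‖f t‖) {t : ℝ}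
    (ht : 0 ≤ t) (n : ℕ) : ‖f (t + n)‖ = ‖f t‖ := by
  induction n with
  | zero => simp
  | succ n ih =>
    rw [Nat.cast_succ, ← add_assoc, h _ (by positivity), ih]

theorem exists_bound_of_norm_periodic {f : ℝ → ℂ} (hf : Continuous f)
    (h : ∀ t, 0 ≤ t → ‖f (t + 1)‖ = ‖f t‖) : ∃ C, 0 ≤ C ∧ ∀ t, 0 ≤ t → ‖f t‖ ≤ C := by
  obtain ⟨C, hC0, hC⟩ := exists_bound_Icc hf 0 1
  refine ⟨C, hC0, fun t ht => ?_⟩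
  obtain ⟨a, ha, n, rfl⟩ := exists_add_natCast_eq ht
  rw [norm_add_natCast_eq h ha.1]
  exact hC a ha

theorem exists_exp_bound {f : ℝ → ℂ} {c : ℝ} (hf : Continuous f)
    (h : ∀ t, 0 ≤ t → ‖f (t + 1)‖ = Real.exp c * ‖f t‖) :
    ∃ C, 0 ≤ C ∧ ∀ t, 0 ≤ t → ‖f t‖ ≤ C * Real.exp (c * t) := by
  have hn : ∀ t, ‖((Real.exp (-(c * t)) : ℝ) : ℂ) * f t‖ = Real.exp (-(c * t)) * ‖f t‖ := by
    intro t
    rw [norm_mul, Complex.norm_real, Real.norm_of_nonneg (Real.exp_pos _).le]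
  obtain ⟨C, hC0, hC⟩ := exists_bound_of_norm_periodic
    (f := fun t => ((Real.exp (-(c * t)) : ℝ) : ℂ) * f t) (by fun_prop) (fun t ht => by
      simp only [hn]
      rw [h t ht, ← mul_assoc, ← Real.exp_add]
      ring_nf)
  refine ⟨C, hC0, fun t ht => ?_⟩
  have := hC t ht
  rw [hn, Real.exp_neg, inv_mul_le_iff₀ (Real.exp_pos _)] at this
  linarith

/-- The integral of |f|^q has the same finite value over (0, ∞) and (1, ∞), so it vanishes over (0,
1]. -/
theorem eq_zero_of_norm_periodic_of_memLp {q : ℝ≥0∞} (hq0 : q ≠ 0) (hq : q ≠ ∞) {f : ℝ → ℂ}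
    (hf : Continuous f) (h : ∀ t, 0 ≤ t → ‖f (t + 1)‖ = ‖f t‖) (hm : MemLp f q halfLine) {t : ℝ}
    (ht : 0 ≤ t) : f t = 0 := by
  set g : ℝ → ℝ≥0∞ := fun t => ‖f t‖ₑ ^ q.toReal with hg
  have hp : 0 < q.toReal := ENNReal.toReal_pos hq0 hq
  have hgm : Measurable g := hf.measurable.enorm.pow_const _
  have hfin : ∫⁻ s in Ioi 0, g s < ∞ :=
    (eLpNorm_lt_top_iff_lintegral_rpow_enorm_lt_top hq0 hq).1 hm.2
  have hshift : ∫⁻ s in Ioi 1, g s = ∫⁻ s in Ioi 0, g s := by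
    have := (measurePreserving_add_right volume (1 : ℝ)).setLIntegral_comp_preimage
      (measurableSet_Ioi (a := (1 : ℝ))) hgm
    rw [← this]
    simp only [preimage_add_const_Ioi, sub_self]
    refine setLIntegral_congr_fun measurableSet_Ioi fun s hs => ?_
    simp only [hg]
    rw [enorm_eq_iff_norm_eq.2 (h s (le_of_lt hs))]
  have hsplit : ∫⁻ s in Ioi 0, g s = (∫⁻ s in Ioc 0 1, g s) + ∫⁻ s in Ioi 1, g s := by
    rw [← lintegral_union measurableSet_Ioi (Ioc_disjoint_Ioi le_rfl),
      Ioc_union_Ioi_eq_Ioi zero_le_one]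
  rw [hshift] at hsplit
  have h0 : ∫⁻ s in Ioc 0 1, g s = 0 := by
    rw [← ENNReal.add_left_inj hfin.ne, zero_add]
    exact hsplit.symm
  rw [lintegral_eq_zero_iff hgm] at h0
  have h1 : f =ᵐ[volume.restrict (Ioc 0 1)] fun _ => 0 := by
    filter_upwards [h0] with s hs
    simpa [hg, ENNReal.rpow_eq_zero_iff, hp, hp.not_gt] using hs
  have h2 : EqOn f (fun _ => 0) (Icc 0 1) := by
    refine Measure.eqOn_Icc_of_ae_eq volume zero_ne_one ?_ hf.continuousOn continuousOn_const
    rwa [Measure.restrict_congr_set Ioc_ae_eq_Icc.symm]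
  obtain ⟨a, ha, n, rfl⟩ := exists_add_natCast_eq ht
  rw [← norm_eq_zero, norm_add_natCast_eq h ha.1, norm_eq_zero]
  exact h2 ha

theorem memLp_shift {q : ℝ≥0∞} {f : ℝ → ℂ} (hm : MemLp f q halfLine) :
    MemLp (fun t => f (t + 1)) q halfLine := by
  have h1 : MemLp f q (volume.restrict (Ioi 1)) :=
    hm.mono_measure (Measure.restrict_mono (Ioi_subset_Ioi zero_le_one) le_rfl)
  have h2 := (measurePreserving_add_right volume (1 : ℝ)).restrict_preimage
    (measurableSet_Ioi (a := (1 : ℝ)))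
  simp only [preimage_add_const_Ioi, sub_self] at h2
  exact h1.comp_measurePreserving h2

/-- The recurrence satisfied by solutions of a periodic equation with multipliers `ρ`, `ρ⁻¹`. -/
def Recur (ρ : ℂ) (f : ℝ → ℂ) : Prop :=
  ∀ t, 0 ≤ t → f (t + 1 + 1) - (ρ + ρ⁻¹) * f (t + 1) + f t = 0

/-- With E the shift by one, the recurrence factors as (E - ρ)(E - ρ⁻¹) f = 0. Using this difference
instead of eigenvectors also covers a Jordan block at ρ = ±1. -/
theorem Recur.sub_eq {ρ : ℂ} {f : ℝ → ℂ} (hρ : ρ ≠ 0) (h : Recur ρ f) {t : ℝ} (ht : 0 ≤ t) :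
    f (t + 1 + 1) - ρ⁻¹ * f (t + 1) = ρ * (f (t + 1) - ρ⁻¹ * f t) := by
  have := mul_inv_cancel₀ hρ
  linear_combination h t ht + f t * this

/-- The difference f(t + 1) - ρ⁻¹ f(t) has periodic modulus and lies in L_q, so it vanishes; then f
itself has periodic modulus. -/
theorem Recur.eq_zero_of_memLp {ρ : ℂ} {f : ℝ → ℂ} (hρ : ‖ρ‖ = 1) (h : Recur ρ f) {q : ℝ≥0∞}
    (hq0 : q ≠ 0) (hq : q ≠ ∞) (hf : Continuous f) (hm : MemLp f q halfLine) {t : ℝ} (ht : 0 ≤ t) :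
    f t = 0 := by
  have hρ0 : ρ ≠ 0 := by rw [← norm_pos_iff, hρ]; exact one_pos
  have hy : ∀ t, 0 ≤ t → f (t + 1) - ρ⁻¹ * f t = 0 := by
    intro t ht
    refine eq_zero_of_norm_periodic_of_memLp (f := fun t => f (t + 1) - ρ⁻¹ * f t) hq0 hq
      (by fun_prop) (fun t ht => ?_) ((memLp_shift hm).sub (hm.const_mul _)) ht
    rw [h.sub_eq hρ0 ht, norm_mul, hρ, one_mul]
  refine eq_zero_of_norm_periodic_of_memLp hq0 hq hf (fun t ht => ?_) hm ht
  rw [sub_eq_zero.1 (hy t ht), norm_mul, norm_inv, hρ, inv_one, one_mul]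

/-- The difference f(t + 1) - ρ⁻¹ f(t) is bounded, so |f| gains at most a constant per period. -/
theorem Recur.exists_linear_bound {ρ : ℂ} {f : ℝ → ℂ} (hρ : ‖ρ‖ = 1) (h : Recur ρ f)
    (hf : Continuous f) : ∃ C, 0 ≤ C ∧ ∀ t, 0 ≤ t → ‖f t‖ ≤ C * (1 + t) := by
  have hρ0 : ρ ≠ 0 := by rw [← norm_pos_iff, hρ]; exact one_pos
  obtain ⟨B, hB0, hB⟩ := exists_bound_of_norm_periodic (f := fun t => f (t + 1) - ρ⁻¹ * f t)
    (by fun_prop) (fun t ht => by rw [h.sub_eq hρ0 ht, norm_mul, hρ, one_mul])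
  obtain ⟨C, hC0, hC⟩ := exists_bound_Icc hf 0 1
  refine ⟨C + B, by positivity, fun t ht => ?_⟩
  obtain ⟨a, ha, n, rfl⟩ := exists_add_natCast_eq ht
  have key : ‖f (a + n)‖ ≤ C + n * B := by
    induction n with
    | zero => simpa using hC a ha
    | succ n ih =>
      have hn : 0 ≤ a + n := add_nonneg ha.1 n.cast_nonneg
      have e : f (a + (n + 1 : ℕ)) = (f (a + n + 1) - ρ⁻¹ * f (a + n)) + ρ⁻¹ * f (a + n) := by
        rw [sub_add_cancel]
        push_cast
        rw [add_assoc]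
      rw [e]
      refine (norm_add_le _ _).trans ?_
      rw [norm_mul, norm_inv, hρ, inv_one, one_mul]
      have := hB _ hn
      have := ih hn
      push_cast
      linarith
  refine key.trans ?_
  have h1 : (0 : ℝ) ≤ n := n.cast_nonneg
  nlinarith [ha.1, mul_nonneg hC0 h1, mul_nonneg hC0 ha.1, mul_nonneg hB0 ha.1]

/-! ### Floquet theory. -/

/-- The fundamental pair normalized at the origin, for a periodic coefficient. -/
structure IsCanonical (W φ φ' ψ ψ' : ℝ → ℂ) : Prop where
  locInt : LocInt W
  periodic : ∀ t, W (t + 1) = W t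
  left : IsHomSol W φ φ'
  right : IsHomSol W ψ ψ'
  φ0 : φ 0 = 1
  φ0' : φ' 0 = 0
  ψ0 : ψ 0 = 0
  ψ0' : ψ' 0 = 1

namespace IsCanonical

variable {W φ φ' ψ ψ' : ℝ → ℂ}

theorem isFundPair (h : IsCanonical W φ φ' ψ ψ') : IsFundPair W φ φ' ψ ψ' :=
  isFundPair_of h.locInt h.left h.right (by rw [h.φ0, h.φ0', h.ψ0']; ring)

theorem repr (h : IsCanonical W φ φ' ψ ψ') {u v : ℝ → ℂ} (hu : IsHomSol W u v) {t : ℝ}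
    (ht : 0 ≤ t) : u t = u 0 * φ t + v 0 * ψ t ∧ v t = u 0 * φ' t + v 0 * ψ' t := by
  have := h.isFundPair.repr h.locInt hu ht
  rw [h.φ0, h.φ0', h.ψ0, h.ψ0'] at this
  refine ⟨this.1.trans ?_, this.2.trans ?_⟩ <;> ring

theorem shift (h : IsCanonical W φ φ' ψ ψ') {u v : ℝ → ℂ} (hu : IsHomSol W u v) {t : ℝ}
    (ht : 0 ≤ t) : u (t + 1) = u 1 * φ t + v 1 * ψ t ∧ v (t + 1) = u 1 * φ' t + v 1 * ψ' t := by
  simpa using h.repr (hu.shift h.locInt h.periodic) ht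

/-- The monodromy matrix has trace `φ 1 + ψ' 1` and, by the Wronskian, determinant 1; the recurrence
is its characteristic equation. -/
theorem cayley_hamilton (h : IsCanonical W φ φ' ψ ψ') {u v : ℝ → ℂ} (hu : IsHomSol W u v) {t : ℝ}
    (ht : 0 ≤ t) : u (t + 1 + 1) - (φ 1 + ψ' 1) * u (t + 1) + u t = 0 ∧
      v (t + 1 + 1) - (φ 1 + ψ' 1) * v (t + 1) + v t = 0 := by
  have hd := h.isFundPair.wr 1 zero_le_one
  have h1 := h.repr hu zero_le_one
  have h2 := h.shift hu zero_le_one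
  have h3 := h.shift (hu.shift h.locInt h.periodic) ht
  have h4 := h.shift hu ht
  have h5 := h.repr hu ht
  rw [h3.1, h3.2, h4.1, h4.2, h5.1, h5.2, h2.1, h2.2, h1.1, h1.2]
  constructor
  · linear_combination (-(u 0 * φ t + v 0 * ψ t)) * hd
  · linear_combination (-(u 0 * φ' t + v 0 * ψ' t)) * hd

/-- The multipliers are the roots of a monic quadratic with constant term 1, so one of them has
modulus at most 1. -/
theorem exists_multiplier (h : IsCanonical W φ φ' ψ ψ') : ∃ ρ : ℂ, ρ ≠ 0 ∧ ‖ρ‖ ≤ 1 ∧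
    ∀ u v, IsHomSol W u v → Recur ρ u ∧ Recur ρ v := by
  obtain ⟨ρ, hρ0, hρ⟩ : ∃ ρ : ℂ, ρ ≠ 0 ∧ φ 1 + ψ' 1 = ρ + ρ⁻¹ := by
    obtain ⟨d, hd⟩ := IsAlgClosed.exists_eq_mul_self ((φ 1 + ψ' 1) ^ 2 - 4)
    have hroot : ((φ 1 + ψ' 1 + d) / 2) * ((φ 1 + ψ' 1 - d) / 2) = 1 := by
      linear_combination hd / 4
    have h0 : (φ 1 + ψ' 1 + d) / 2 ≠ 0 := left_ne_zero_of_mul_eq_one hroot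
    refine ⟨(φ 1 + ψ' 1 + d) / 2, h0, ?_⟩
    rw [inv_eq_of_mul_eq_one_right hroot]
    ring
  have key : ∀ r : ℂ, φ 1 + ψ' 1 = r + r⁻¹ → ∀ u v, IsHomSol W u v → Recur r u ∧ Recur r v := by
    intro r hr u v hu
    constructor
    · intro t ht
      rw [← hr]
      exact (h.cayley_hamilton hu ht).1
    · intro t ht
      rw [← hr]
      exact (h.cayley_hamilton hu ht).2
  rcases le_total ‖ρ‖ 1 with h1 | h1
  · exact ⟨ρ, hρ0, h1, key ρ hρ⟩
  · refine ⟨ρ⁻¹, inv_ne_zero hρ0, ?_, key ρ⁻¹ (by rw [inv_inv, hρ, add_comm])⟩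
    rw [norm_inv]
    exact inv_le_one_of_one_le₀ h1

/-- The resolvent kernel grows at most linearly if the multipliers have modulus one. -/
theorem exists_kernel_bound (h : IsCanonical W φ φ' ψ ψ') {ρ : ℂ} (hρ : ‖ρ‖ = 1)
    (hrec : ∀ u v, IsHomSol W u v → Recur ρ u ∧ Recur ρ v) :
    ∃ C, 0 ≤ C ∧ ∀ t s, 0 ≤ t → t ≤ s →
      ‖φ t * ψ s - ψ t * φ s‖ ≤ C * (1 + (s - t)) ∧
      ‖φ' t * ψ s - ψ' t * φ s‖ ≤ C * (1 + (s - t)) := by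
  have hd := h.isFundPair.wr 1 zero_le_one
  obtain ⟨A, hA0, hA⟩ := (hrec _ _ h.left).1.exists_linear_bound hρ h.left.cont
  obtain ⟨B, hB0, hB⟩ := (hrec _ _ h.right).1.exists_linear_bound hρ h.right.cont
  obtain ⟨c₁, hc₁0, hc₁⟩ := exists_bound_Icc h.left.cont 0 1
  obtain ⟨c₂, hc₂0, hc₂⟩ := exists_bound_Icc h.right.cont 0 1
  obtain ⟨c₃, hc₃0, hc₃⟩ := exists_bound_Icc h.left.cont' 0 1
  obtain ⟨c₄, hc₄0, hc₄⟩ := exists_bound_Icc h.right.cont' 0 1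
  -- Shifting both arguments by a period multiplies these expressions by the monodromy determinant,
  -- which is 1. So t may be taken in [0, 1], and only s contributes growth.
  have hper : ∀ t s, 0 ≤ t → 0 ≤ s → ∀ n : ℕ,
      φ (t + n) * ψ (s + n) - ψ (t + n) * φ (s + n) = φ t * ψ s - ψ t * φ s ∧
      φ' (t + n) * ψ (s + n) - ψ' (t + n) * φ (s + n) = φ' t * ψ s - ψ' t * φ s := by
    intro t s ht hs n
    induction n with
    | zero => simp
    | succ n ih =>
      have ht' : 0 ≤ t + n := by positivity
      have hs' : 0 ≤ s + n := by positivity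
      rw [← ih.1, ← ih.2]
      push_cast
      rw [← add_assoc, ← add_assoc]
      have l1 := h.shift h.left ht'
      have l2 := h.shift h.left hs'
      have r1 := h.shift h.right ht'
      have r2 := h.shift h.right hs'
      rw [l1.1, l1.2, l2.1, r1.1, r1.2, r2.1]
      constructor
      · linear_combination (φ (t + n) * ψ (s + n) - ψ (t + n) * φ (s + n)) * hd
      · linear_combination (φ' (t + n) * ψ (s + n) - ψ' (t + n) * φ (s + n)) * hd
  have hest : ∀ x y a b : ℂ, ∀ c c' r : ℝ, 0 ≤ c → 0 ≤ c' → 1 ≤ r → ‖x‖ ≤ c → ‖y‖ ≤ c' →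
      ‖a‖ ≤ B * (1 + r) → ‖b‖ ≤ A * (1 + r) → ‖x * a - y * b‖ ≤ (c * B + c' * A) * (2 * r) := by
    intro x y a b c c' r hc hc' hr hx hy ha hb
    refine (norm_sub_le _ _).trans ?_
    rw [norm_mul, norm_mul]
    have e1 := mul_le_mul hx ha (norm_nonneg _) hc
    have e2 := mul_le_mul hy hb (norm_nonneg _) hc'
    have e3 : (c * B + c' * A) * (1 + r) ≤ (c * B + c' * A) * (2 * r) :=
      mul_le_mul_of_nonneg_left (by linarith) (by positivity)
    linarith
  refine ⟨2 * (c₁ * B + c₂ * A) + 2 * (c₃ * B + c₄ * A), by positivity, fun t s ht hts => ?_⟩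
  obtain ⟨a, ha, n, rfl⟩ := exists_add_natCast_eq ht
  obtain ⟨s, rfl⟩ : ∃ s', s = s' + n := ⟨s - n, by ring⟩
  have has : a ≤ s := by linarith
  have hs : 0 ≤ s := ha.1.trans has
  rw [(hper a s ha.1 hs n).1, (hper a s ha.1 hs n).2]
  have hr : 1 ≤ 1 + (s - a) := by linarith
  have hs1 : 1 + s ≤ 1 + (1 + (s - a)) := by linarith [ha.2]
  have e1 := hest _ _ _ _ c₁ c₂ _ hc₁0 hc₂0 hr (hc₁ a ha) (hc₂ a ha)
    ((hB s hs).trans (mul_le_mul_of_nonneg_left hs1 hB0))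
    ((hA s hs).trans (mul_le_mul_of_nonneg_left hs1 hA0))
  have e2 := hest _ _ _ _ c₃ c₄ _ hc₃0 hc₄0 hr (hc₃ a ha) (hc₄ a ha)
    ((hB s hs).trans (mul_le_mul_of_nonneg_left hs1 hB0))
    ((hA s hs).trans (mul_le_mul_of_nonneg_left hs1 hA0))
  have e3 : s + n - (a + n) = s - a := by ring
  rw [e3]
  have f1 : 0 ≤ (c₁ * B + c₂ * A) * (1 + (s - a)) := mul_nonneg (by positivity) (by linarith)
  have f2 : 0 ≤ (c₃ * B + c₄ * A) * (1 + (s - a)) := mul_nonneg (by positivity) (by linarith)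
  constructor <;> nlinarith

/-- For any solution u, the combination u(t + 1) - ρ⁻¹ u(t) has multiplier ρ. If it vanished for
both φ and ψ, the monodromy matrix would be ρ⁻¹ times the identity, and determinant 1 would force
|ρ| = 1. -/
theorem exists_floquet (h : IsCanonical W φ φ' ψ ψ') {ρ : ℂ} (hρ0 : ρ ≠ 0) (hρ : ‖ρ‖ ≠ 1)
    (hrec : ∀ u v, IsHomSol W u v → Recur ρ u ∧ Recur ρ v) :
    ∃ u v, IsHomSol W u v ∧ (u 0 ≠ 0 ∨ v 0 ≠ 0) ∧
      ∀ t, 0 ≤ t → u (t + 1) = ρ * u t ∧ v (t + 1) = ρ * v t := by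
  have key : ∀ u v, IsHomSol W u v →
      IsHomSol W (fun t => u (t + 1) + (-ρ⁻¹) * u t) (fun t => v (t + 1) + (-ρ⁻¹) * v t) ∧
      ∀ t, 0 ≤ t → u (t + 1 + 1) + (-ρ⁻¹) * u (t + 1) = ρ * (u (t + 1) + (-ρ⁻¹) * u t) ∧
        v (t + 1 + 1) + (-ρ⁻¹) * v (t + 1) = ρ * (v (t + 1) + (-ρ⁻¹) * v t) := by
    intro u v hu
    refine ⟨(hu.shift h.locInt h.periodic).add h.locInt (hu.const_mul _), fun t ht => ⟨?_, ?_⟩⟩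
    · have := (hrec u v hu).1.sub_eq hρ0 ht
      linear_combination this
    · have := (hrec u v hu).2.sub_eq hρ0 ht
      linear_combination this
  obtain ⟨k1, k2⟩ := key _ _ h.left
  obtain ⟨l1, l2⟩ := key _ _ h.right
  by_contra! hcon
  have n1 := fun h0 => hcon _ _ k1 h0
  have n2 := fun h0 => hcon _ _ l1 h0
  have m1 : φ (0 + 1) + -ρ⁻¹ * φ 0 = 0 ∧ φ' (0 + 1) + -ρ⁻¹ * φ' 0 = 0 := by
    by_contra hne
    obtain ⟨t, ht, hh⟩ := n1 (by tauto)
    exact hh (k2 t ht).1 (k2 t ht).2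
  have m2 : ψ (0 + 1) + -ρ⁻¹ * ψ 0 = 0 ∧ ψ' (0 + 1) + -ρ⁻¹ * ψ' 0 = 0 := by
    by_contra hne
    obtain ⟨t, ht, hh⟩ := n2 (by tauto)
    exact hh (l2 t ht).1 (l2 t ht).2
  rw [h.φ0, h.φ0', zero_add] at m1
  rw [h.ψ0, h.ψ0', zero_add] at m2
  have hd := h.isFundPair.wr 1 zero_le_one
  have hsq : ρ⁻¹ * ρ⁻¹ = 1 := by
    linear_combination hd - ψ' 1 * m1.1 - ρ⁻¹ * m2.2 + ψ 1 * m1.2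
  apply hρ
  have := congrArg norm hsq
  rw [norm_mul, norm_one, norm_inv] at this
  have h2 : ‖ρ‖⁻¹ = 1 := by nlinarith [inv_nonneg.2 (norm_nonneg ρ)]
  exact inv_eq_one.1 h2

/-- Exponentially decaying and growing solutions with Wronskian `1`. -/
theorem exists_dichotomy (h : IsCanonical W φ φ' ψ ψ') {ρ : ℂ} (hρ0 : ρ ≠ 0) (hρ : ‖ρ‖ < 1)
    (hrec : ∀ u v, IsHomSol W u v → Recur ρ u ∧ Recur ρ v) :
    ∃ c > 0, ∃ C, 0 ≤ C ∧ ∃ f f' g g' : ℝ → ℂ, IsFundPair W f f' g g' ∧ ∀ t, 0 ≤ t →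
      ‖f t‖ ≤ C * Real.exp (-(c * t)) ∧ ‖f' t‖ ≤ C * Real.exp (-(c * t)) ∧
      ‖g t‖ ≤ C * Real.exp (c * t) ∧ ‖g' t‖ ≤ C * Real.exp (c * t) := by
  have hinv : ∀ f, Recur ρ f → Recur ρ⁻¹ f := by
    intro f hf t ht
    rw [inv_inv, add_comm ρ⁻¹ ρ]
    exact hf t ht
  obtain ⟨f, f', hf, hf0, hfρ⟩ := h.exists_floquet hρ0 hρ.ne hrec
  obtain ⟨g, g', hg, hg0, hgρ⟩ := h.exists_floquet (ρ := ρ⁻¹) (inv_ne_zero hρ0)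
    (by rw [norm_inv]; simpa using hρ.ne)
    fun u v hu => ⟨hinv u (hrec u v hu).1, hinv v (hrec u v hu).2⟩
  have hne : ρ⁻¹ - ρ ≠ 0 := by
    intro h0
    have := congrArg norm (sub_eq_zero.1 h0)
    rw [norm_inv] at this
    have hpos : 0 < ‖ρ‖ := norm_pos_iff.2 hρ0
    have h1 : 1 < ‖ρ‖⁻¹ := (one_lt_inv₀ hpos).2 hρ
    linarith
  -- A zero Wronskian makes the initial vectors parallel. As they belong to distinct eigenvalues ρ
  -- and ρ⁻¹, all four products of their components vanish, although neither vector is zero.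
  have hw : f 0 * g' 0 - f' 0 * g 0 ≠ 0 := by
    intro hw
    have a1 := h.repr hf zero_le_one
    have b1 := h.repr hg zero_le_one
    have a2 := hfρ 0 le_rfl
    have b2 := hgρ 0 le_rfl
    rw [zero_add] at a2 b2
    have c1 : (ρ⁻¹ - ρ) * (f 0 * g 0) = 0 := by
      linear_combination (-f 0) * b2.1 + f 0 * b1.1 + g 0 * a2.1 - g 0 * a1.1 + ψ 1 * hw
    have c2 : (ρ⁻¹ - ρ) * (f 0 * g' 0) = 0 := by
      linear_combination (-f 0) * b2.2 + f 0 * b1.2 + g 0 * a2.2 - g 0 * a1.2 + (ψ' 1 - ρ) * hw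
    have c3 : (ρ⁻¹ - ρ) * (f' 0 * g 0) = 0 := by
      linear_combination (-f' 0) * b2.1 + f' 0 * b1.1 + g' 0 * a2.1 - g' 0 * a1.1
        + (ρ - φ 1) * hw
    have c4 : (ρ⁻¹ - ρ) * (f' 0 * g' 0) = 0 := by
      linear_combination (-f' 0) * b2.2 + f' 0 * b1.2 + g' 0 * a2.2 - g' 0 * a1.2 - φ' 1 * hw
    simp only [mul_eq_zero, hne, false_or] at c1 c2 c3 c4
    tauto
  have hρn : ‖ρ‖ = Real.exp (-(-Real.log ‖ρ‖)) := by
    rw [neg_neg, Real.exp_log (norm_pos_iff.2 hρ0)]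
  have hρi : ‖ρ⁻¹‖ = Real.exp (-Real.log ‖ρ‖) := by
    rw [Real.exp_neg, Real.exp_log (norm_pos_iff.2 hρ0), norm_inv]
  set c := -Real.log ‖ρ‖ with hc
  have hc0 : 0 < c := neg_pos.2 (Real.log_neg (norm_pos_iff.2 hρ0) hρ)
  set w := f 0 * g' 0 - f' 0 * g 0 with hwd
  obtain ⟨C₁, hC₁, h1⟩ := exists_exp_bound (c := -c) hf.cont fun t ht => by
    rw [(hfρ t ht).1, norm_mul, ← hρn]
  obtain ⟨C₂, hC₂, h2⟩ := exists_exp_bound (c := -c) hf.cont' fun t ht => by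
    rw [(hfρ t ht).2, norm_mul, ← hρn]
  have hg2 := hg.const_mul w⁻¹
  obtain ⟨C₃, hC₃, h3⟩ := exists_exp_bound (c := c) hg2.cont fun t ht => by
    rw [(hgρ t ht).1, mul_left_comm, norm_mul, hρi]
  obtain ⟨C₄, hC₄, h4⟩ := exists_exp_bound (c := c) hg2.cont' fun t ht => by
    rw [(hgρ t ht).2, mul_left_comm, norm_mul, hρi]
  refine ⟨c, hc0, C₁ + C₂ + C₃ + C₄, by positivity, f, f', _, _,
    isFundPair_of h.locInt hf hg2 ?_, fun t ht => ⟨?_, ?_, ?_, ?_⟩⟩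
  · rw [mul_left_comm, mul_left_comm (f' 0), ← mul_sub, ← hwd, inv_mul_cancel₀ hw]
  · refine (h1 t ht).trans ?_
    rw [neg_mul]
    gcongr
    linarith
  · refine (h2 t ht).trans ?_
    rw [neg_mul]
    gcongr
    linarith
  · refine (h3 t ht).trans ?_
    gcongr
    linarith
  · refine (h4 t ht).trans ?_
    gcongr
    linarith

end IsCanonical

/-! ### The perturbation as a decaying weight times a bounded triangular operator. -/

section Perturbation

variable {q : ℝ≥0∞} [Fact (1 ≤ q)]

/-- The weight `(1 + t)^{-δ}`. -/
noncomputable def wt (δ : ℝ) (t : ℝ) : ℂ := (((1 + t) ^ (-δ) : ℝ) : ℂ)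

theorem measurable_wt (δ : ℝ) : Measurable (wt δ) := by
  unfold wt
  fun_prop

theorem norm_wt {δ t : ℝ} (ht : 0 ≤ t) : ‖wt δ t‖ = (1 + t) ^ (-δ) := by
  rw [wt, Complex.norm_real, Real.norm_of_nonneg (Real.rpow_nonneg (by linarith) _)]

theorem wt_mul_rpow {δ t : ℝ} (ht : 0 ≤ t) : wt δ t * (((1 + t) ^ δ : ℝ) : ℂ) = 1 := by
  rw [wt, ← Complex.ofReal_mul, ← Real.rpow_add (by linarith), neg_add_cancel, Real.rpow_zero,
    Complex.ofReal_one]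

theorem one_add_rpow_neg_le_one {δ t : ℝ} (hδ : 0 ≤ δ) (ht : 0 ≤ t) : (1 + t) ^ (-δ) ≤ 1 :=
  Real.rpow_le_one_of_one_le_of_nonpos (by linarith) (by linarith)

theorem exists_weight_clm {δ : ℝ} (hδ : 0 ≤ δ) : ∃ D : LpHalf q →L[ℂ] LpHalf q,
    (∀ u, D u =ᵐ[halfLine] fun t => wt δ t * u t) ∧
    ∀ T, 0 ≤ T → ‖cut (Ioi T) * D‖ ≤ (1 + T) ^ (-δ) := by
  obtain ⟨D, -, hD⟩ := exists_mul_clm (q := q) (m := wt δ) (C := 1)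
    (measurable_wt δ).aestronglyMeasurable (by
      filter_upwards [ae_restrict_mem measurableSet_Ioi] with t ht
      rw [norm_wt (le_of_lt ht)]
      exact one_add_rpow_neg_le_one hδ (le_of_lt ht))
  refine ⟨D, hD, fun T hT => ?_⟩
  obtain ⟨C, hC⟩ : ∃ C : ℝ≥0, (C : ℝ) = (1 + T) ^ (-δ) :=
    ⟨⟨(1 + T) ^ (-δ), Real.rpow_nonneg (by linarith) _⟩, rfl⟩
  rw [← hC]
  refine opNorm_le_of_eLpNorm_le fun u => ?_
  refine eLpNorm_le_nnreal_smul_eLpNorm_of_ae_le_mul ?_ q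
  rw [mul_apply_eq_comp]
  filter_upwards [coeFn_cut measurableSet_Ioi (D u), hD u] with t h1 h2
  rw [h1]
  by_cases h : t ∈ Ioi T
  · have hTt : T < t := h
    rw [indicator_of_mem h, h2, ← NNReal.coe_le_coe, NNReal.coe_mul, coe_nnnorm, coe_nnnorm,
      norm_mul, norm_wt (hT.trans hTt.le), hC]
    refine mul_le_mul_of_nonneg_right ?_ (norm_nonneg _)
    exact Real.rpow_le_rpow_of_nonpos (by linarith) (by linarith) (by linarith)
  · simp [indicator_of_notMem h]

/-- Multiplying the coefficient and the kernel by (1 + t)^δ leaves bounded operators, so all the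
decay is carried by the weight factored out. -/
theorem exists_perturbation_clm {δ : ℝ} {b : ℝ → ℂ} {k : ℝ → ℝ → ℂ}
    (hb : MemLp (fun t => (((1 + t) ^ δ : ℝ) : ℂ) * b t) ∞ halfLine)
    (hk : ∀ᵐ z : ℝ × ℝ ∂(halfLine.prod halfLine), z.2 < z.1 → k z.1 z.2 = 0)
    (hbdd : IsBoundedKernel q (fun t s => (((1 + t) ^ δ : ℝ) : ℂ) * k t s)) :
    ∃ Q : LpHalf q →L[ℂ] LpHalf q, (∀ A, IsTriangular A Q) ∧
      ∀ u, ∀ᵐ t ∂halfLine, wt δ t * Q u t = b t * u t + ∫ s, k t s * u s ∂halfLine := by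
  obtain ⟨M, -, hM⟩ := exists_mul_clm (q := q) hb.1
    (C := (eLpNorm (fun t => (((1 + t) ^ δ : ℝ) : ℂ) * b t) ∞ halfLine).toNNReal) (by
      filter_upwards [ae_le_eLpNormEssSup (f := fun t => (((1 + t) ^ δ : ℝ) : ℂ) * b t)] with t ht
      rw [← eLpNorm_exponent_top] at ht
      have := ENNReal.toNNReal_mono hb.2.ne ht
      rw [toNNReal_enorm] at this
      exact_mod_cast this)
  obtain ⟨K, hK⟩ := hbdd.exists_clm
  refine ⟨M + K, fun A => (isTriangular_of_mul hM).add (isTriangular_of_kernel hK ?_), fun u => ?_⟩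
  · intro a _
    filter_upwards [Measure.ae_ae_of_ae_prod hk] with t ht
    filter_upwards [ht] with s hs hat hsa
    rw [hs (hsa.trans_lt hat), mul_zero]
  · rw [add_apply]
    filter_upwards [hM u, hK u, Lp.coeFn_add (M u) (K u), ae_restrict_mem measurableSet_Ioi]
      with t h1 h2 h3 ht
    have e := wt_mul_rpow (δ := δ) (le_of_lt ht)
    rw [h3, Pi.add_apply, h1, h2]
    simp_rw [mul_assoc]
    rw [integral_const_mul]
    linear_combination (b t * u t + ∫ s, k t s * u s ∂halfLine) * e

end Perturbation

/-! ### Passage between the operator H and the differential equation. -/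

section Conversion

variable {q : ℝ≥0∞} [Fact (1 ≤ q)] {V b₁ b₂ : ℝ → ℂ} {k₁ k₂ : ℝ → ℝ → ℂ}

/-- `P₁ u + P₂ u'` is the perturbation applied to `u`, where `u'` is the derivative of `u`. -/
structure IsPerturbation (b₁ b₂ : ℝ → ℂ) (k₁ k₂ : ℝ → ℝ → ℂ)
    (P₁ P₂ : LpHalf q →L[ℂ] LpHalf q) : Prop where
  one : ∀ u, ∀ᵐ t ∂halfLine, P₁ u t = b₂ t * u t + ∫ s, k₂ t s * u s ∂halfLine
  two : ∀ u, ∀ᵐ t ∂halfLine, P₂ u t = b₁ t * (Complex.I • u : LpHalf q) t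
    + ∫ s, k₁ t s * (Complex.I • u : LpHalf q) s ∂halfLine

/-- Since D² u = -u'', the equation u'' = (V - z) u - g says (D² + V - z) u = g; the perturbation is
added on top. -/
theorem isHill_of_isSol {P₁ P₂ : LpHalf q →L[ℂ] LpHalf q} (hP : IsPerturbation b₁ b₂ k₁ k₂ P₁ P₂)
    (hV : MemLp V ∞ volume) {z : ℂ} {u u' g : LpHalf q} {w v : ℝ → ℂ}
    (hsol : IsSol (fun t => V t - z) (fun t => -g t) w v) (hu : u =ᵐ[halfLine] w)
    (hu' : u' =ᵐ[halfLine] v) :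
    IsHill V b₁ b₂ k₁ k₂ u (g + z • u + (P₁ u + P₂ u')) := by
  have hV' : MemLp V ∞ halfLine := hV.restrict _
  obtain ⟨M, -, hM⟩ := exists_mul_clm (q := q) hV'.1 (C := (eLpNorm V ∞ halfLine).toNNReal) (by
      filter_upwards [ae_le_eLpNormEssSup (f := V)] with t ht
      rw [← eLpNorm_exponent_top] at ht
      have := ENNReal.toNNReal_mono hV'.2.ne ht
      rw [toNNReal_enorm] at this
      exact_mod_cast this)
  have h1 : HasLpDeriv u u' := by
    refine ⟨w, hsol.ac, hu, ?_⟩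
    filter_upwards [hsol.deriv, hu'] with t h1 h2
    rwa [h2]
  have hmem : ∀ᵐ t ∂halfLine, (M u - z • u - g) t = V t * u t - z * u t - g t := by
    filter_upwards [hM u, Lp.coeFn_sub (M u - z • u) g, Lp.coeFn_sub (M u) (z • u),
      Lp.coeFn_smul z u] with t h1 h2 h3 h4
    rw [h2, Pi.sub_apply, h3, Pi.sub_apply, h4, Pi.smul_apply, h1, smul_eq_mul]
  have h2 : HasLpDeriv (Complex.I • u') (Complex.I • (M u - z • u - g)) := by
    refine ⟨fun t => Complex.I * v t, hsol.ac'.const_mul _, ?_, ?_⟩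
    · filter_upwards [hu', Lp.coeFn_smul Complex.I u'] with t h1 h2
      rw [h2, Pi.smul_apply, h1, smul_eq_mul]
    · filter_upwards [hsol.deriv', hu, hmem, Lp.coeFn_smul Complex.I (M u - z • u - g)]
        with t h1 h2 h3 h4
      rw [h4, Pi.smul_apply, h3, smul_eq_mul, h2]
      refine (h1.const_mul Complex.I).congr_deriv ?_
      ring
  refine ⟨Complex.I • u', Complex.I • Complex.I • (M u - z • u - g), ⟨u', h1, rfl⟩,
    ⟨_, h2, rfl⟩, ?_⟩
  rw [smul_smul, Complex.I_mul_I, neg_one_smul]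
  filter_upwards [hmem, hP.one u, hP.two u', Lp.coeFn_neg (M u - z • u - g),
    Lp.coeFn_add (g + z • u) (P₁ u + P₂ u'), Lp.coeFn_add g (z • u), Lp.coeFn_smul z u,
    Lp.coeFn_add (P₁ u) (P₂ u')] with t e1 e2 e3 e4 e5 e6 e7 e8
  rw [e5, Pi.add_apply, e6, Pi.add_apply, e7, Pi.smul_apply, e8, Pi.add_apply, e2, e3, e4,
    Pi.neg_apply, e1, smul_eq_mul]
  ring

theorem exists_isSol_of_isHill {P₁ P₂ : LpHalf q →L[ℂ] LpHalf q}
    (hP : IsPerturbation b₁ b₂ k₁ k₂ P₁ P₂) {z : ℂ} {u : LpHalf q}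
    (h : IsHill V b₁ b₂ k₁ k₂ u (z • u)) :
    ∃ (u' : LpHalf q) (w v : ℝ → ℂ),
      IsSol (fun t => V t - z) (fun t => (P₁ u + P₂ u') t) w v ∧
      u =ᵐ[halfLine] w ∧ u' =ᵐ[halfLine] v := by
  obtain ⟨u₁, u₂, ⟨u', ⟨w, hw, huw, hdw⟩, rfl⟩, ⟨x, ⟨y, hy, huy, hdy⟩, rfl⟩, hf⟩ := h
  -- `y` represents D u = i u', whence the factor -i.
  have hv : u' =ᵐ[halfLine] fun t => -Complex.I * y t := by
    filter_upwards [huy, Lp.coeFn_smul Complex.I u'] with t h1 h2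
    rw [← h1, h2, Pi.smul_apply, smul_eq_mul, ← mul_assoc, neg_mul, Complex.I_mul_I, neg_neg,
      one_mul]
  refine ⟨u', w, fun t => -Complex.I * y t, ⟨hw, LocAC.const_mul hy _, ?_, ?_⟩, huw, hv⟩
  · filter_upwards [hdw, hv] with t h1 h2
    rwa [h2] at h1
  · filter_upwards [hdy, hf, huw, hP.one u, hP.two u', Lp.coeFn_add (P₁ u) (P₂ u'),
      Lp.coeFn_smul z u, Lp.coeFn_smul Complex.I x] with t h1 h2 h3 h4 h5 h6 h7 h8
    refine (h1.const_mul (-Complex.I)).congr_deriv ?_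
    rw [h6, Pi.add_apply, h4, h5, ← h3]
    rw [h7, h8, Pi.smul_apply, Pi.smul_apply, smul_eq_mul, smul_eq_mul] at h2
    linear_combination h2

end Conversion

/-! ### Integral estimates. -/

theorem integral_Ioi_one_add_rpow {δ a : ℝ} (hδ : 2 < δ) (ha : 0 ≤ a) :
    IntegrableOn (fun s : ℝ => (1 + s) ^ (1 - δ)) (Ioi a) ∧
      ∫ s in Ioi a, (1 + s) ^ (1 - δ) = (1 + a) ^ (2 - δ) / (δ - 2) := by
  have hd : ∀ x ∈ Ici a, HasDerivAt (fun s : ℝ => -((1 + s) ^ (2 - δ) / (δ - 2)))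
      ((1 + x) ^ (1 - δ)) x := by
    intro x hx
    have hx0 : 0 < 1 + x := by linarith [show a ≤ x from hx]
    have h1 : HasDerivAt (fun s : ℝ => 1 + s) 1 x := (hasDerivAt_id x).const_add 1
    refine ((h1.rpow_const (p := 2 - δ) (Or.inl hx0.ne')).div_const (δ - 2)).neg.congr_deriv ?_
    rw [show 2 - δ - 1 = 1 - δ by ring]
    have : δ - 2 ≠ 0 := by linarith
    field_simp
    ring
  have hlim : Tendsto (fun s : ℝ => -((1 + s) ^ (2 - δ) / (δ - 2))) atTop (𝓝 0) := by
    have h1 : Tendsto (fun s : ℝ => 1 + s) atTop atTop := tendsto_atTop_add_const_left _ _ tendsto_id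
    have h2 := (tendsto_rpow_neg_atTop (y := δ - 2) (by linarith)).comp h1
    simpa [Function.comp_def] using (h2.div_const (δ - 2)).neg
  have hpos : ∀ x ∈ Ioi a, 0 ≤ (1 + x : ℝ) ^ (1 - δ) := fun x hx =>
    Real.rpow_nonneg (by linarith [show a < x from hx]) _
  refine ⟨integrableOn_Ioi_deriv_of_nonneg' hd hpos hlim, ?_⟩
  rw [integral_Ioi_of_hasDerivAt_of_nonneg' hd hpos hlim]
  ring

theorem setLIntegral_Ioi_one_add_rpow {δ a C : ℝ} (hδ : 2 < δ) (ha : 0 ≤ a) (hC : 0 ≤ C) :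
    ∫⁻ s in Ioi a, ENNReal.ofReal (C * (1 + s) ^ (1 - δ))
      = ENNReal.ofReal (C * ((1 + a) ^ (2 - δ) / (δ - 2))) := by
  obtain ⟨h1, h2⟩ := integral_Ioi_one_add_rpow hδ ha
  rw [← h2, ← integral_const_mul]
  refine (ofReal_integral_eq_lintegral_ofReal (h1.const_mul C) ?_).symm
  filter_upwards [ae_restrict_mem measurableSet_Ioi] with s hs
  exact mul_nonneg hC (Real.rpow_nonneg (by linarith [show a < s from hs]) _)

theorem enorm_le_ofReal {x : ℂ} {r : ℝ} (h : ‖x‖ ≤ r) : ‖x‖ₑ ≤ ENNReal.ofReal r := by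
  rw [← ofReal_norm]
  exact ENNReal.ofReal_le_ofReal h

theorem schurBound_Ioc {k : ℝ → ℝ → ℂ} {a b C : ℝ} (hC : 0 ≤ C) (ha : 0 ≤ a)
    (hk : ∀ t s, 0 < t → 0 < s → ‖k t s‖ ≤ C) : SchurBound k (Ioc a b) (C * (b - a)).toNNReal := by
  have key : ∀ f : ℝ → ℂ, (∀ s, 0 < s → ‖f s‖ ≤ C) →
      ∫⁻ s in Ioc a b, ‖f s‖ₑ ≤ ((C * (b - a)).toNNReal : ℝ≥0∞) := by
    intro f hf
    calc _ ≤ ∫⁻ s in Ioc a b, ENNReal.ofReal C :=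
          setLIntegral_mono' measurableSet_Ioc fun s hs => enorm_le_ofReal (hf s (ha.trans_lt hs.1))
      _ = _ := by
          rw [setLIntegral_const, Real.volume_Ioc, ← ENNReal.ofReal_mul hC]
          rfl
  exact ⟨fun t ht => key _ fun s hs => hk t s (ha.trans_lt ht.1) hs,
    fun s hs => key _ fun t ht => hk t s ht (ha.trans_lt hs.1)⟩

/-- A function that is bounded and integrable can be integrated against `L_q`. -/
theorem integrable_mul_of_bounded {q : ℝ≥0∞} [Fact (1 ≤ q)] (hq : q ≠ ∞) {m : ℝ → ℂ} {B : ℝ}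
    (hB : ∀ᵐ t ∂halfLine, ‖m t‖ ≤ B) (hm : Integrable m halfLine) (u : LpHalf q) :
    Integrable (fun t => m t * u t) halfLine := by
  have hp := one_le_toReal_of_fact hq
  have hq0 : q ≠ 0 := (zero_lt_one.trans_le (Fact.out : 1 ≤ q)).ne'
  have hu : Integrable (fun t => ‖u t‖ ^ q.toReal) halfLine := (Lp.memLp u).integrable_norm_rpow hq0 hq
  refine (hm.norm.add (hu.const_mul B)).mono' (hm.1.mul (Lp.aestronglyMeasurable u)) ?_
  filter_upwards [hB] with t ht
  rw [norm_mul, Pi.add_apply]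
  -- This elementary bound takes the place of Hölder and treats q = 1 like the other exponents.
  have hx : ‖u t‖ ≤ 1 + ‖u t‖ ^ q.toReal := by
    rcases le_total ‖u t‖ 1 with h | h
    · exact h.trans (le_add_of_nonneg_right (by positivity))
    · have := Real.rpow_le_rpow_of_exponent_le h hp
      rw [Real.rpow_one] at this
      linarith
  calc ‖m t‖ * ‖u t‖ ≤ ‖m t‖ * (1 + ‖u t‖ ^ q.toReal) := by gcongr
    _ = ‖m t‖ + ‖m t‖ * ‖u t‖ ^ q.toReal := by ring
    _ ≤ _ := by gcongr

theorem LocAC.eq_add_integral {F f : ℝ → ℂ} (hF : LocAC F) (hf : LocInt f)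
    (h : ∀ᵐ t ∂halfLine, HasDerivAt F (f t) t) {t : ℝ} (ht : 0 ≤ t) :
    F t = F 0 + ∫ s in (0 : ℝ)..t, f s := by
  obtain ⟨h1, h2⟩ := locAC_of_integral (F := fun t => ∫ s in (0 : ℝ)..t, f s) hf
    (fun t _ => by simp)
  have := (hF.sub h1).eq_of_deriv_zero (by
    filter_upwards [h, h2] with t a b
    exact (a.sub b).congr_deriv (sub_self _)) ht
  simp only [intervalIntegral.integral_same] at this
  linear_combination this

theorem locInt_of_integrable {f : ℝ → ℂ} (hf : Integrable f halfLine) : LocInt f := by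
  intro b hb
  rw [intervalIntegrable_iff_integrableOn_Ioc_of_le hb.le]
  exact IntegrableOn.mono_set hf Ioc_subset_Ioi_self

theorem integral_zero_to_eq {f : ℝ → ℂ} (hf : Integrable f halfLine) {t : ℝ} (ht : 0 ≤ t) :
    ∫ s in (0 : ℝ)..t, f s = (∫ s in Ioi 0, f s) - ∫ s in Ioi t, f s := by
  rw [intervalIntegral.integral_Ioi_sub_Ioi hf ht]

/-! ### Multipliers of modulus one: L_q solutions vanish. -/

section Subexponential

variable {q : ℝ≥0∞} [Fact (1 ≤ q)]

/-- The kernel of the resolvent integrated from infinity, with the weight `(1 + s)^{-δ}`. -/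
noncomputable def backKernel (δ : ℝ) (θ η φ ψ : ℝ → ℂ) (t s : ℝ) : ℂ :=
  if t < s then (θ t * ψ s - η t * φ s) * wt δ s else 0

theorem measurable_backKernel {δ : ℝ} {θ η φ ψ : ℝ → ℂ} (hθ : Continuous θ) (hη : Continuous η)
    (hφ : Continuous φ) (hψ : Continuous ψ) :
    Measurable (Function.uncurry (backKernel δ θ η φ ψ)) := by
  have hw : Measurable fun z : ℝ × ℝ => wt δ z.2 := (measurable_wt δ).comp measurable_snd
  exact Measurable.ite (measurableSet_lt measurable_fst measurable_snd)
    ((by fun_prop : Continuous fun z : ℝ × ℝ => θ z.1 * ψ z.2 - η z.1 * φ z.2).measurable.mul hw)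
    measurable_const

theorem norm_backKernel_le {δ C : ℝ} {θ η φ ψ : ℝ → ℂ} (hC : 0 ≤ C)
    (hb : ∀ t s, 0 ≤ t → t ≤ s → ‖θ t * ψ s - η t * φ s‖ ≤ C * (1 + (s - t))) {t s : ℝ}
    (ht : 0 ≤ t) (hs : 0 ≤ s) : ‖backKernel δ θ η φ ψ t s‖ ≤ C * (1 + s) ^ (1 - δ) := by
  have h0 : 0 ≤ (1 + s) ^ (-δ) := Real.rpow_nonneg (by linarith) _
  rw [backKernel]
  split_ifs with h
  · rw [norm_mul, norm_wt hs, sub_eq_add_neg 1 δ, Real.rpow_add (by linarith), Real.rpow_one,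
      ← mul_assoc]
    refine mul_le_mul_of_nonneg_right ((hb t s ht h.le).trans ?_) h0
    gcongr
    linarith
  · rw [norm_zero]
    exact mul_nonneg hC (Real.rpow_nonneg (by linarith) _)

/-- Rows are tails of the integral of (1 + s)^(1 - δ), finite since δ > 2. Columns are supported in
t < s, giving (s - a)(1 + s)^(1 - δ) ≤ (1 + a)^(2 - δ). Both bounds tend to zero as a grows. -/
theorem schurBound_backKernel {δ C a : ℝ} {θ η φ ψ : ℝ → ℂ} (hδ : 2 < δ) (hC : 0 ≤ C) (ha : 0 ≤ a)
    (hb : ∀ t s, 0 ≤ t → t ≤ s → ‖θ t * ψ s - η t * φ s‖ ≤ C * (1 + (s - t))) :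
    SchurBound (backKernel δ θ η φ ψ) (Ioi a)
      (C * (1 + (δ - 2)⁻¹) * (1 + a) ^ (2 - δ)).toNNReal := by
  have h0 : 0 ≤ (1 + a) ^ (2 - δ) := Real.rpow_nonneg (by linarith) _
  have h1 : 0 < δ - 2 := by linarith
  constructor
  · intro t ht
    calc _ ≤ ∫⁻ s in Ioi a, ENNReal.ofReal (C * (1 + s) ^ (1 - δ)) :=
          setLIntegral_mono' measurableSet_Ioi fun s hs => enorm_le_ofReal
            (norm_backKernel_le hC hb (ha.trans (le_of_lt ht)) (ha.trans (le_of_lt hs)))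
      _ = _ := setLIntegral_Ioi_one_add_rpow hδ ha hC
      _ ≤ ENNReal.ofReal (C * (1 + (δ - 2)⁻¹) * (1 + a) ^ (2 - δ)) := by
          apply ENNReal.ofReal_le_ofReal
          rw [mul_assoc, div_eq_inv_mul]
          gcongr
          linarith
  · intro s hs
    have hs' : a < s := hs
    calc _ ≤ ∫⁻ t in Ioi a, (Iio s).indicator (fun _ => ENNReal.ofReal (C * (1 + s) ^ (1 - δ))) t := by
          refine setLIntegral_mono' measurableSet_Ioi fun t ht => ?_
          by_cases h : t < s
          · rw [indicator_of_mem (show t ∈ Iio s from h)]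
            exact enorm_le_ofReal
              (norm_backKernel_le hC hb (ha.trans (le_of_lt ht)) (ha.trans hs'.le))
          · simp [backKernel, h]
      _ = ENNReal.ofReal (C * (1 + s) ^ (1 - δ) * (s - a)) := by
          have h2 : 0 ≤ C * (1 + s) ^ (1 - δ) := mul_nonneg hC (Real.rpow_nonneg (by linarith) _)
          rw [lintegral_indicator measurableSet_Iio, setLIntegral_const,
            Measure.restrict_apply measurableSet_Iio, inter_comm, Ioi_inter_Iio, Real.volume_Ioo,
            ← ENNReal.ofReal_mul h2]
      _ ≤ ENNReal.ofReal (C * (1 + (δ - 2)⁻¹) * (1 + a) ^ (2 - δ)) := by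
          apply ENNReal.ofReal_le_ofReal
          have e1 : (1 + s) ^ (1 - δ) * (s - a) ≤ (1 + a) ^ (2 - δ) := by
            calc (1 + s) ^ (1 - δ) * (s - a) ≤ (1 + s) ^ (1 - δ) * (1 + s) := by
                  refine mul_le_mul_of_nonneg_left (by linarith) (Real.rpow_nonneg (by linarith) _)
              _ = (1 + s) ^ (2 - δ) := by
                  rw [← Real.rpow_add_one (by linarith)]
                  ring_nf
              _ ≤ _ := Real.rpow_le_rpow_of_nonpos (by linarith) (by linarith) (by linarith)
          rw [mul_assoc, mul_assoc]
          refine mul_le_mul_of_nonneg_left (e1.trans ?_) hC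
          have : 0 ≤ (δ - 2)⁻¹ := by positivity
          nlinarith

theorem norm_cut_mul_mul_cut_le_of_isTriangular {T : ℝ} {Q G : LpHalf q →L[ℂ] LpHalf q}
    {A : Set ℝ} (hT : T ∈ A) (hQ : IsTriangular A Q) :
    ‖cut (Ioi T) * (Q * G) * cut (Ioi T)‖ ≤ ‖cut (Ioi T) * Q‖ * ‖cut (Ioi T) * G * cut (Ioi T)‖ := by
  have e1 : (cut (Ioi T) * cut (Ioi T) : LpHalf q →L[ℂ] LpHalf q) = cut (Ioi T) := by
    rw [cut_mul_cut measurableSet_Ioi measurableSet_Ioi, inter_self]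
  have e : cut (Ioi T) * (Q * G) * cut (Ioi T)
      = (cut (Ioi T) * Q) * (cut (Ioi T) * G * cut (Ioi T)) := by
    rw [← mul_assoc (cut (Ioi T)) Q G, ← hQ T hT]
    calc _ = (cut (Ioi T) * Q) * (cut (Ioi T) * G * cut (Ioi T)) := by simp only [mul_assoc]
      _ = (cut (Ioi T) * Q) * ((cut (Ioi T) * cut (Ioi T)) * G * cut (Ioi T)) := by rw [e1]
      _ = _ := by simp only [mul_assoc]
  rw [e]
  exact norm_mul_le _ _

/-- The Schur bound on (T, ∞) makes the tail small for large T, and the kernel is bounded by C, so a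
diagonal block of either G has norm at most C times its length. -/
theorem exists_isUnit_backKernel (hq : q ≠ ∞) {δ : ℝ} (hδ : 2 < δ) {φ φ' ψ ψ' : ℝ → ℂ}
    (hφ : Continuous φ) (hφ' : Continuous φ') (hψ : Continuous ψ) (hψ' : Continuous ψ') {C : ℝ}
    (hC : 0 ≤ C)
    (hb : ∀ t s, 0 ≤ t → t ≤ s → ‖φ t * ψ s - ψ t * φ s‖ ≤ C * (1 + (s - t)))
    (hb' : ∀ t s, 0 ≤ t → t ≤ s → ‖φ' t * ψ s - ψ' t * φ s‖ ≤ C * (1 + (s - t)))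
    {Q₁ Q₂ : LpHalf q →L[ℂ] LpHalf q} (hQ₁ : ∀ A, IsTriangular A Q₁) (hQ₂ : ∀ A, IsTriangular A Q₂) :
    ∃ G₁ G₂ : LpHalf q →L[ℂ] LpHalf q,
      (∀ u, G₁ u =ᵐ[halfLine] fun t => ∫ s, backKernel δ φ ψ φ ψ t s * u s ∂halfLine) ∧
      (∀ u, G₂ u =ᵐ[halfLine] fun t => ∫ s, backKernel δ φ' ψ' φ ψ t s * u s ∂halfLine) ∧
      IsUnit (1 + (Q₁ * G₁ + Q₂ * G₂)) := by
  have hm := measurable_backKernel (δ := δ) hφ hψ hφ hψ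
  have hm' := measurable_backKernel (δ := δ) hφ' hψ' hφ hψ
  have hS := fun a (ha : 0 ≤ a) => schurBound_backKernel hδ hC ha hb
  have hS' := fun a (ha : 0 ≤ a) => schurBound_backKernel hδ hC ha hb'
  obtain ⟨G₁, hG₁⟩ := (isBoundedKernel_of_schur hq hm (hS 0 le_rfl)).exists_clm
  obtain ⟨G₂, hG₂⟩ := (isBoundedKernel_of_schur hq hm' (hS' 0 le_rfl)).exists_clm
  refine ⟨G₁, G₂, hG₁, hG₂, ?_⟩
  set c := C * (1 + (δ - 2)⁻¹) with hc
  have hc0 : 0 ≤ c := by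
    have : 0 < δ - 2 := by linarith
    positivity
  have hlim : Tendsto (fun T : ℝ => (‖Q₁‖ + ‖Q₂‖) * (c * (1 + T) ^ (2 - δ))) atTop (𝓝 0) := by
    have h1 : Tendsto (fun s : ℝ => 1 + s) atTop atTop := tendsto_atTop_add_const_left _ _ tendsto_id
    have h2 := (tendsto_rpow_neg_atTop (y := δ - 2) (by linarith)).comp h1
    simpa [Function.comp_def] using (h2.const_mul c).const_mul (‖Q₁‖ + ‖Q₂‖)
  obtain ⟨T, hT1, hT0⟩ := ((hlim.eventually (gt_mem_nhds one_pos)).and (eventually_ge_atTop 0)).exists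
  have tri : ∀ (θ η : ℝ → ℂ) (G : LpHalf q →L[ℂ] LpHalf q),
      (∀ u, G u =ᵐ[halfLine] fun t => ∫ s, backKernel δ θ η φ ψ t s * u s ∂halfLine) →
      IsTriangular (Icc 0 T) G := by
    intro θ η G hG
    refine isTriangular_of_kernel hG fun a _ => .of_forall fun t => .of_forall fun s hat hsa => ?_
    simp [backKernel, (hsa.trans_lt hat).le]
  have htail : ∀ (θ η : ℝ → ℂ) (Q G : LpHalf q →L[ℂ] LpHalf q), (∀ A, IsTriangular A Q) →
      Measurable (Function.uncurry (backKernel δ θ η φ ψ)) →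
      (∀ u, G u =ᵐ[halfLine] fun t => ∫ s, backKernel δ θ η φ ψ t s * u s ∂halfLine) →
      SchurBound (backKernel δ θ η φ ψ) (Ioi T) (c * (1 + T) ^ (2 - δ)).toNNReal →
      ‖cut (Ioi T) * (Q * G) * cut (Ioi T)‖ ≤ ‖Q‖ * (c * (1 + T) ^ (2 - δ)) := by
    intro θ η Q G hQ hk hG hs
    refine (norm_cut_mul_mul_cut_le_of_isTriangular (mem_univ T) (hQ univ)).trans ?_
    have h1 := norm_cut_mul_mul_cut_le hq hk measurableSet_Ioi (Ioi_subset_Ioi hT0) hG hs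
    rw [Real.coe_toNNReal _ (mul_nonneg hc0 (Real.rpow_nonneg (by linarith) _))] at h1
    have h2 : ‖cut (Ioi T) * Q‖ ≤ ‖Q‖ := (norm_mul_le _ _).trans
      (mul_le_of_le_one_left (norm_nonneg _) (norm_cut_le _ measurableSet_Ioi))
    gcongr
  have hloc : ∀ (θ η : ℝ → ℂ) (G : LpHalf q →L[ℂ] LpHalf q),
      Measurable (Function.uncurry (backKernel δ θ η φ ψ)) →
      (∀ u, G u =ᵐ[halfLine] fun t => ∫ s, backKernel δ θ η φ ψ t s * u s ∂halfLine) →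
      (∀ t s, 0 ≤ t → t ≤ s → ‖θ t * ψ s - η t * φ s‖ ≤ C * (1 + (s - t))) →
      ∀ a b, 0 ≤ a → a ≤ b → b ≤ T → ‖cut (Ioc a b) * G * cut (Ioc a b)‖ ≤ C * (b - a) := by
    intro θ η G hk hG hbd a b ha hab _
    have h1 := norm_cut_mul_mul_cut_le hq hk measurableSet_Ioc
      (fun t ht => ha.trans_lt ht.1) hG (schurBound_Ioc (a := a) (b := b) hC ha
        fun t s ht hs => (norm_backKernel_le hC hbd ht.le hs.le).trans
          (mul_le_of_le_one_right hC
            (Real.rpow_le_one_of_one_le_of_nonpos (by linarith) (by linarith))))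
    rwa [Real.coe_toNNReal _ (mul_nonneg hC (by linarith))] at h1
  refine isUnit_one_add_of_isTriangular (C := C) hT0 (hQ₁ _) (hQ₂ _) (tri _ _ _ hG₁)
    (tri _ _ _ hG₂) ?_ (hloc _ _ _ hm hG₁ hb) (hloc _ _ _ hm' hG₂ hb')
  rw [mul_add, add_mul]
  refine (norm_add_le _ _).trans_lt ((add_le_add (htail _ _ _ _ hQ₁ hm hG₁ (hS T hT0))
    (htail _ _ _ _ hQ₂ hm' hG₂ (hS' T hT0))).trans_lt ?_)
  rw [← add_mul]
  exact hT1

end Subexponential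

/-- Variation of constants from infinity: up to sign, β and γ are the limits at infinity of the
Wronskians of w with φ and ψ, which exist by the integrability assumptions. -/
theorem IsSol.exists_repr_tail {W k w v φ φ' ψ ψ' : ℝ → ℂ} (hW : LocInt W)
    (h : IsFundPair W φ φ' ψ ψ') (hsol : IsSol W k w v)
    (hφ : Integrable (fun t => φ t * k t) halfLine) (hψ : Integrable (fun t => ψ t * k t) halfLine) :
    ∃ β γ : ℂ, ∀ t, 0 ≤ t →
      w t = (β * ψ t + γ * φ t)
        + (φ t * (∫ s in Ioi t, ψ s * k s) - ψ t * ∫ s in Ioi t, φ s * k s) ∧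
      v t = (β * ψ' t + γ * φ' t)
        + (φ' t * (∫ s in Ioi t, ψ s * k s) - ψ' t * ∫ s in Ioi t, φ s * k s) := by
  obtain ⟨a1, a2⟩ := hsol.wronskian (h.left.isSol hW)
  obtain ⟨b1, b2⟩ := hsol.wronskian (h.right.isSol hW)
  refine ⟨φ 0 * v 0 - φ' 0 * w 0 + ∫ s in Ioi 0, φ s * k s,
    -(ψ 0 * v 0 - ψ' 0 * w 0 + ∫ s in Ioi 0, ψ s * k s), fun t ht => ?_⟩
  have ea := a1.eq_add_integral (locInt_of_integrable hφ) a2 ht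
  have eb := b1.eq_add_integral (locInt_of_integrable hψ) b2 ht
  rw [integral_zero_to_eq hφ ht] at ea
  rw [integral_zero_to_eq hψ ht] at eb
  have hw := h.wr t ht
  constructor
  · linear_combination (-w t) * hw + ψ t * ea - φ t * eb
  · linear_combination (-v t) * hw + ψ' t * ea - φ' t * eb

section Subexponential

variable {q : ℝ≥0∞} [Fact (1 ≤ q)]

theorem integrable_mul_wt {δ : ℝ} (hδ : 2 < δ) {f : ℝ → ℂ} (hf : Continuous f) {C : ℝ}
    (hC : 0 ≤ C) (hb : ∀ t, 0 ≤ t → ‖f t‖ ≤ C * (1 + t)) (hq : q ≠ ∞) (u : LpHalf q) :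
    Integrable (fun t => f t * (wt δ t * u t)) halfLine := by
  have hle : ∀ᵐ t ∂halfLine, ‖f t * wt δ t‖ ≤ C * (1 + t) ^ (1 - δ) := by
    filter_upwards [ae_restrict_mem measurableSet_Ioi] with t ht
    have ht' : 0 < t := ht
    rw [norm_mul, norm_wt ht'.le, sub_eq_add_neg 1 δ, Real.rpow_add (by linarith), Real.rpow_one,
      ← mul_assoc]
    exact mul_le_mul_of_nonneg_right (hb t ht'.le) (Real.rpow_nonneg (by linarith) _)
  have hint : Integrable (fun t => f t * wt δ t) halfLine :=
    ((integral_Ioi_one_add_rpow hδ le_rfl).1.const_mul C).mono'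
      (hf.measurable.mul (measurable_wt δ)).aestronglyMeasurable hle
  have := integrable_mul_of_bounded hq (B := C) (by
    filter_upwards [hle, ae_restrict_mem measurableSet_Ioi] with t h1 ht
    have ht' : 0 < t := ht
    exact h1.trans (mul_le_of_le_one_right hC
      (Real.rpow_le_one_of_one_le_of_nonpos (by linarith) (by linarith)))) hint u
  simpa only [mul_assoc] using this

theorem integral_backKernel {δ : ℝ} {θ η φ ψ u : ℝ → ℂ} {t : ℝ} (ht : 0 ≤ t)
    (hφ : Integrable (fun s => φ s * (wt δ s * u s)) halfLine)
    (hψ : Integrable (fun s => ψ s * (wt δ s * u s)) halfLine) :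
    ∫ s, backKernel δ θ η φ ψ t s * u s ∂halfLine
      = θ t * (∫ s in Ioi t, ψ s * (wt δ s * u s)) - η t * ∫ s in Ioi t, φ s * (wt δ s * u s) := by
  have hφ' := IntegrableOn.mono_set hφ (Ioi_subset_Ioi ht)
  have hψ' := IntegrableOn.mono_set hψ (Ioi_subset_Ioi ht)
  rw [← integral_const_mul, ← integral_const_mul, ← integral_sub (hψ'.const_mul _) (hφ'.const_mul _)]
  have e : ∀ s, backKernel δ θ η φ ψ t s * u s = (Ioi t).indicator
      (fun s => θ t * (ψ s * (wt δ s * u s)) - η t * (φ s * (wt δ s * u s))) s := by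
    intro s
    by_cases h : t < s
    · rw [indicator_of_mem (show s ∈ Ioi t from h), backKernel, if_pos h]
      ring
    · rw [indicator_of_notMem (show s ∉ Ioi t from h), backKernel, if_neg h, zero_mul]
  simp_rw [e]
  rw [integral_indicator measurableSet_Ioi, Measure.restrict_restrict measurableSet_Ioi,
    Ioi_inter_Ioi, max_eq_left ht]

/-- If the multipliers have modulus one, a solution of the perturbed equation in `L_q` vanishes. -/
theorem IsCanonical.eq_zero_of_isSol {W φ φ' ψ ψ' : ℝ → ℂ} (h : IsCanonical W φ φ' ψ ψ') {ρ : ℂ}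
    (hρ : ‖ρ‖ = 1) (hrec : ∀ u v, IsHomSol W u v → Recur ρ u ∧ Recur ρ v) (hq : q ≠ ∞) {δ : ℝ}
    (hδ : 2 < δ) {Q₁ Q₂ : LpHalf q →L[ℂ] LpHalf q} (hQ₁ : ∀ A, IsTriangular A Q₁)
    (hQ₂ : ∀ A, IsTriangular A Q₂) {u u' : LpHalf q} {w v : ℝ → ℂ}
    (hsol : IsSol W (fun t => wt δ t * (Q₁ u + Q₂ u') t) w v) (hu : u =ᵐ[halfLine] w)
    (hu' : u' =ᵐ[halfLine] v) : u = 0 := by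
  have hq0 : q ≠ 0 := (zero_lt_one.trans_le (Fact.out : 1 ≤ q)).ne'
  set x := Q₁ u + Q₂ u' with hx
  obtain ⟨C, hC, hb⟩ := h.exists_kernel_bound hρ hrec
  obtain ⟨A, hA0, hA⟩ := (hrec _ _ h.left).1.exists_linear_bound hρ h.left.cont
  obtain ⟨B, hB0, hB⟩ := (hrec _ _ h.right).1.exists_linear_bound hρ h.right.cont
  have hφx := integrable_mul_wt hδ h.left.cont hA0 hA hq x
  have hψx := integrable_mul_wt hδ h.right.cont hB0 hB hq x
  obtain ⟨G₁, G₂, hG₁, hG₂, hunit⟩ := exists_isUnit_backKernel hq hδ h.left.cont h.left.cont'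
    h.right.cont h.right.cont' hC (fun t s ht hts => (hb t s ht hts).1)
    (fun t s ht hts => (hb t s ht hts).2) (Q₁ := (-1 : ℂ) • Q₁) (Q₂ := (-1 : ℂ) • Q₂)
    (fun A => (hQ₁ A).smul _) (fun A => (hQ₂ A).smul _)
  obtain ⟨β, γ, hrep⟩ := hsol.exists_repr_tail h.locInt h.isFundPair hφx hψx
  have hom : IsHomSol W (fun t => β * ψ t + γ * φ t) (fun t => β * ψ' t + γ * φ' t) :=
    (h.right.const_mul β).add h.locInt (h.left.const_mul γ)
  -- The homogeneous part is a difference of two L_q functions, so it must vanish when |ρ| = 1.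
  have e1 : (fun t => β * ψ t + γ * φ t) =ᵐ[halfLine] (u - G₁ x : LpHalf q) := by
    filter_upwards [hu, hG₁ x, Lp.coeFn_sub u (G₁ x), ae_restrict_mem measurableSet_Ioi]
      with t h1 h2 h3 ht
    rw [h3, Pi.sub_apply, h1, h2, integral_backKernel (le_of_lt ht) hφx hψx,
      (hrep t (le_of_lt ht)).1, add_sub_cancel_right]
  have e2 : (fun t => β * ψ' t + γ * φ' t) =ᵐ[halfLine] (u' - G₂ x : LpHalf q) := by
    filter_upwards [hu', hG₂ x, Lp.coeFn_sub u' (G₂ x), ae_restrict_mem measurableSet_Ioi]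
      with t h1 h2 h3 ht
    rw [h3, Pi.sub_apply, h1, h2, integral_backKernel (le_of_lt ht) hφx hψx,
      (hrep t (le_of_lt ht)).2, add_sub_cancel_right]
  have z1 : ∀ t, 0 ≤ t → β * ψ t + γ * φ t = 0 := fun t ht =>
    (hrec _ _ hom).1.eq_zero_of_memLp hρ hq0 hq hom.cont
      ((memLp_congr_ae e1).2 (Lp.memLp _)) ht
  have z2 : ∀ t, 0 ≤ t → β * ψ' t + γ * φ' t = 0 := fun t ht =>
    (hrec _ _ hom).2.eq_zero_of_memLp hρ hq0 hq hom.cont'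
      ((memLp_congr_ae e2).2 (Lp.memLp _)) ht
  have r1 : u = G₁ x := by
    rw [← sub_eq_zero]
    apply Lp.ext
    filter_upwards [e1, Lp.coeFn_zero ℂ q halfLine, ae_restrict_mem measurableSet_Ioi] with t h1 h2 ht
    rw [← h1, h2, z1 t (le_of_lt ht), Pi.zero_apply]
  have r2 : u' = G₂ x := by
    rw [← sub_eq_zero]
    apply Lp.ext
    filter_upwards [e2, Lp.coeFn_zero ℂ q halfLine, ae_restrict_mem measurableSet_Ioi] with t h1 h2 ht
    rw [← h1, h2, z2 t (le_of_lt ht), Pi.zero_apply]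
  -- Substituting u = G₁ x and u' = G₂ x into x = Q₁ u + Q₂ u' makes x a fixed point of Q₁ G₁ + Q₂
  -- G₂.
  have hx0 : (1 + ((-1 : ℂ) • Q₁ * G₁ + (-1 : ℂ) • Q₂ * G₂)) x = 0 := by
    simp only [add_apply, mul_apply_eq_comp, one_apply_eq_self, smul_apply]
    rw [← r1, ← r2, hx]
    module
  obtain ⟨U, hU⟩ := hunit
  have hxz : x = 0 := by
    have : (↑U⁻¹ * ↑U : LpHalf q →L[ℂ] LpHalf q) x = 0 := by
      rw [mul_apply_eq_comp, hU, hx0, map_zero]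
    simpa using this
  rw [r1, hxz, map_zero]

end Subexponential

/-! ### Exponential dichotomy: a bounded right inverse of H - z. -/

theorem integrable_exp_neg_mul_abs {c : ℝ} (hc : 0 < c) :
    Integrable (fun x : ℝ => Real.exp (-(c * |x|))) volume := by
  have h1 : IntegrableOn (fun x : ℝ => Real.exp (-(c * |x|))) (Ioi 0) := by
    refine (exp_neg_integrableOn_Ioi 0 hc).congr_fun (fun x hx => ?_) measurableSet_Ioi
    simp only
    rw [abs_of_pos hx, neg_mul]
  have h2 : IntegrableOn (fun x : ℝ => Real.exp (-(c * |x|))) (Iic 0) := by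
    refine (integrableOn_exp_mul_Iic hc 0).congr_fun (fun x hx => ?_) measurableSet_Iic
    simp only
    rw [abs_of_nonpos hx, mul_neg, neg_neg]
  rw [← integrableOn_univ, ← Iic_union_Ioi (a := (0 : ℝ))]
  exact h2.union h1

/-- The Green kernel of an exponential dichotomy, made triangular on `(0, T]`. -/
noncomputable def greenKernel (T : ℝ) (θ η f g : ℝ → ℂ) (t s : ℝ) : ℂ :=
  (if T < s ∧ s ≤ t then θ t * g s else 0) - (if t < s ∧ s ≤ T then θ t * g s else 0)
    + if t < s then η t * f s else 0

theorem measurable_greenKernel {T : ℝ} {θ η f g : ℝ → ℂ} (hθ : Continuous θ) (hη : Continuous η)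
    (hf : Continuous f) (hg : Continuous g) :
    Measurable (Function.uncurry (greenKernel T θ η f g)) := by
  have h1 : Measurable fun z : ℝ × ℝ => θ z.1 * g z.2 :=
    (by fun_prop : Continuous fun z : ℝ × ℝ => θ z.1 * g z.2).measurable
  have h2 : Measurable fun z : ℝ × ℝ => η z.1 * f z.2 :=
    (by fun_prop : Continuous fun z : ℝ × ℝ => η z.1 * f z.2).measurable
  have m1 : MeasurableSet {z : ℝ × ℝ | T < z.2 ∧ z.2 ≤ z.1} :=
    (measurableSet_lt measurable_const measurable_snd).inter
      (measurableSet_le measurable_snd measurable_fst)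
  have m2 : MeasurableSet {z : ℝ × ℝ | z.1 < z.2 ∧ z.2 ≤ T} :=
    (measurableSet_lt measurable_fst measurable_snd).inter
      (measurableSet_le measurable_snd measurable_const)
  exact ((Measurable.ite m1 h1 measurable_const).sub (Measurable.ite m2 h1 measurable_const)).add
    (Measurable.ite (measurableSet_lt measurable_fst measurable_snd) h2 measurable_const)

/-- The bounds of an exponential dichotomy. -/
structure IsDichotomy (c C : ℝ) (θ η f g : ℝ → ℂ) : Prop where
  pos : 0 < c
  nonneg : 0 ≤ C
  θ_le : ∀ t, 0 ≤ t → ‖θ t‖ ≤ C * Real.exp (-(c * t))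
  η_le : ∀ t, 0 ≤ t → ‖η t‖ ≤ C * Real.exp (c * t)
  f_le : ∀ t, 0 ≤ t → ‖f t‖ ≤ C * Real.exp (-(c * t))
  g_le : ∀ t, 0 ≤ t → ‖g t‖ ≤ C * Real.exp (c * t)

namespace IsDichotomy

variable {c C T : ℝ} {θ η f g : ℝ → ℂ}

theorem norm_mul_g_le (h : IsDichotomy c C θ η f g) {t s : ℝ} (ht : 0 ≤ t) (hs : 0 ≤ s) :
    ‖θ t * g s‖ ≤ C ^ 2 * Real.exp (c * (s - t)) := by
  rw [norm_mul]
  refine (mul_le_mul (h.θ_le t ht) (h.g_le s hs) (norm_nonneg _)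
    (mul_nonneg h.nonneg (Real.exp_pos _).le)).trans_eq ?_
  rw [mul_mul_mul_comm, ← Real.exp_add]
  ring_nf

theorem norm_mul_f_le (h : IsDichotomy c C θ η f g) {t s : ℝ} (ht : 0 ≤ t) (hs : 0 ≤ s) :
    ‖η t * f s‖ ≤ C ^ 2 * Real.exp (c * (t - s)) := by
  rw [norm_mul]
  refine (mul_le_mul (h.η_le t ht) (h.f_le s hs) (norm_nonneg _)
    (mul_nonneg h.nonneg (Real.exp_pos _).le)).trans_eq ?_
  rw [mul_mul_mul_comm, ← Real.exp_add]
  ring_nf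

/-- The exponential term is the usual Green kernel estimate. The constant term pays for θ(t) g(s) on
t < s ≤ T, where the product may grow, but only up to C² exp(cT). -/
theorem norm_greenKernel_le (h : IsDichotomy c C θ η f g) {t s : ℝ} (ht : 0 ≤ t)
    (hs : 0 ≤ s) : ‖greenKernel T θ η f g t s‖ ≤ C ^ 2 * Real.exp (-(c * |t - s|))
      + if t < T ∧ s ≤ T then C ^ 2 * Real.exp (c * T) else 0 := by
  have hc := h.pos
  have hnn : 0 ≤ if t < T ∧ s ≤ T then C ^ 2 * Real.exp (c * T) else 0 := by
    split_ifs <;> positivity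
  rw [greenKernel]
  rcases lt_or_ge t s with hts | hts
  · rw [if_neg (fun h' => absurd h'.2 (not_le.2 hts)), if_pos hts, zero_sub, abs_of_neg (sub_neg.2 hts)]
    have e1 := h.norm_mul_f_le ht hs
    have e3 : c * (t - s) = -(c * -(t - s)) := by ring
    rw [← e3]
    by_cases hsT : s ≤ T
    · rw [if_pos ⟨hts, hsT⟩, if_pos ⟨hts.trans_le hsT, hsT⟩]
      refine (norm_add_le _ _).trans ?_
      rw [norm_neg, add_comm]
      refine add_le_add e1 ((h.norm_mul_g_le ht hs).trans ?_)
      gcongr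
      linarith
    · rw [if_neg (fun h' => hsT h'.2), neg_zero, zero_add, if_neg (fun h' => hsT h'.2), add_zero]
      exact e1
  · rw [if_neg (c := t < s ∧ s ≤ T) (fun h' => absurd h'.1 (not_lt.2 hts)),
      if_neg (not_lt.2 hts), sub_zero, add_zero, abs_of_nonneg (sub_nonneg.2 hts)]
    refine le_trans ?_ (le_add_of_nonneg_right hnn)
    have e3 : c * (s - t) = -(c * (t - s)) := by ring
    rw [← e3]
    split_ifs
    · exact h.norm_mul_g_le ht hs
    · rw [norm_zero]
      positivity

theorem lintegral_exp_le (hc : 0 < c) (C : ℝ) (I : Set ℝ) (t : ℝ) :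
    ∫⁻ s in I, ENNReal.ofReal (C ^ 2 * Real.exp (-(c * |t - s|)))
      ≤ ENNReal.ofReal (C ^ 2 * ∫ x : ℝ, Real.exp (-(c * |x|))) := by
  refine (setLIntegral_le_lintegral _ _).trans_eq ?_
  rw [lintegral_sub_left_eq_self (fun x => ENNReal.ofReal (C ^ 2 * Real.exp (-(c * |x|)))) t,
    ← integral_const_mul]
  refine (ofReal_integral_eq_lintegral_ofReal ((integrable_exp_neg_mul_abs hc).const_mul _)
    (.of_forall fun x => ?_)).symm
  simp only [Pi.zero_apply]
  positivity

/-- Beyond T the correction term is absent, so the bound does not depend on T. This allows T to be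
chosen afterwards. -/
theorem schurBound_tail (h : IsDichotomy c C θ η f g) (hT : 0 ≤ T) :
    SchurBound (greenKernel T θ η f g) (Ioi T)
      (C ^ 2 * ∫ x : ℝ, Real.exp (-(c * |x|))).toNNReal := by
  have hle : ∀ t ∈ Ioi T, ∀ s ∈ Ioi T,
      ‖greenKernel T θ η f g t s‖ ≤ C ^ 2 * Real.exp (-(c * |t - s|)) := by
    intro t ht s hs
    have ht' : T < t := ht
    have hs' : T < s := hs
    have := h.norm_greenKernel_le (T := T) (hT.trans ht'.le) (hT.trans hs'.le)
    rwa [if_neg (fun h' => absurd h'.2 (not_le.2 hs')), add_zero] at this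
  constructor
  · intro t ht
    exact (setLIntegral_mono' measurableSet_Ioi fun s hs => enorm_le_ofReal (hle t ht s hs)).trans
      (lintegral_exp_le h.pos C _ t)
  · intro s hs
    refine (setLIntegral_mono' measurableSet_Ioi fun t ht => enorm_le_ofReal (hle t ht s hs)).trans ?_
    simp_rw [abs_sub_comm _ s]
    exact lintegral_exp_le h.pos C _ s

theorem exists_schurBound (h : IsDichotomy c C θ η f g) (T : ℝ) :
    ∃ B, SchurBound (greenKernel T θ η f g) (Ioi 0) B := by
  set K : ℝ := C ^ 2 * Real.exp (c * T) with hK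
  have hK0 : 0 ≤ K := by positivity
  set J : ℝ := C ^ 2 * ∫ x : ℝ, Real.exp (-(c * |x|)) with hJ
  have hfin : ENNReal.ofReal J + ENNReal.ofReal K * ENNReal.ofReal T ≠ ∞ := by finiteness
  have hle : ∀ t ∈ Ioi (0 : ℝ), ∀ s ∈ Ioi (0 : ℝ), ‖greenKernel T θ η f g t s‖ₑ
      ≤ ENNReal.ofReal (C ^ 2 * Real.exp (-(c * |t - s|)))
        + if t ≤ T ∧ s ≤ T then ENNReal.ofReal K else 0 := by
    intro t ht s hs
    refine (enorm_le_ofReal (h.norm_greenKernel_le (le_of_lt ht) (le_of_lt hs))).trans ?_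
    refine ENNReal.ofReal_add_le.trans ?_
    gcongr
    split_ifs with h1 h2 h2
    · exact le_rfl
    · exact absurd ⟨h1.1.le, h1.2⟩ h2
    · simp
    · simp
  have hind : ∀ t : ℝ, ∫⁻ s in Ioi 0, (if t ≤ T ∧ s ≤ T then ENNReal.ofReal K else 0)
      ≤ ENNReal.ofReal K * ENNReal.ofReal T := by
    intro t
    calc _ ≤ ∫⁻ s in Ioi 0, (Iic T).indicator (fun _ => ENNReal.ofReal K) s := by
          refine lintegral_mono fun s => ?_
          by_cases hs : s ≤ T
          · rw [indicator_of_mem (show s ∈ Iic T from hs)]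
            split_ifs <;> simp
          · simp [hs]
      _ = _ := by
          rw [lintegral_indicator measurableSet_Iic, setLIntegral_const,
            Measure.restrict_apply measurableSet_Iic, inter_comm, Ioi_inter_Iic, Real.volume_Ioc,
            sub_zero]
  have hmeas : ∀ t : ℝ, Measurable fun s => ENNReal.ofReal (C ^ 2 * Real.exp (-(c * |t - s|))) := by
    intro t
    fun_prop
  refine ⟨(ENNReal.ofReal J + ENNReal.ofReal K * ENNReal.ofReal T).toNNReal, ?_⟩
  rw [SchurBound, ENNReal.coe_toNNReal hfin]
  constructor
  · intro t ht
    refine (setLIntegral_mono' measurableSet_Ioi (hle t ht)).trans ?_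
    rw [lintegral_add_left (hmeas t)]
    exact add_le_add (lintegral_exp_le h.pos C _ t) (hind t)
  · intro s hs
    refine (setLIntegral_mono' measurableSet_Ioi fun t ht => hle t ht s hs).trans ?_
    simp_rw [abs_sub_comm _ s, and_comm (b := s ≤ T)]
    rw [lintegral_add_left (hmeas s)]
    exact add_le_add (lintegral_exp_le h.pos C _ s) (hind s)

theorem norm_greenKernel_le_const (h : IsDichotomy c C θ η f g) {t s : ℝ} (ht : 0 < t)
    (hs : 0 < s) : ‖greenKernel T θ η f g t s‖ ≤ C ^ 2 + C ^ 2 * Real.exp (c * T) := by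
  refine (h.norm_greenKernel_le ht.le hs.le).trans (add_le_add ?_ ?_)
  · refine mul_le_of_le_one_right (sq_nonneg _) ?_
    rw [Real.exp_le_one_iff, neg_nonpos]
    exact mul_nonneg h.pos.le (abs_nonneg _)
  · split_ifs
    · exact le_rfl
    · positivity

theorem integrable_f_mul {q : ℝ≥0∞} [Fact (1 ≤ q)] (h : IsDichotomy c C θ η f g) (hf : Continuous f)
    (hq : q ≠ ∞) (u : LpHalf q) : Integrable (fun t => f t * u t) halfLine := by
  have hle : ∀ᵐ t ∂halfLine, ‖f t‖ ≤ C * Real.exp (-c * t) := by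
    filter_upwards [ae_restrict_mem measurableSet_Ioi] with t ht
    simpa using h.f_le t (le_of_lt ht)
  refine integrable_mul_of_bounded hq (B := C) ?_
    (((exp_neg_integrableOn_Ioi 0 h.pos).const_mul C).mono' hf.aestronglyMeasurable hle) u
  filter_upwards [hle, ae_restrict_mem measurableSet_Ioi] with t h1 ht
  refine h1.trans (mul_le_of_le_one_right h.nonneg ?_)
  rw [Real.exp_le_one_iff]
  nlinarith [h.pos, show (0 : ℝ) < t from ht]

end IsDichotomy

section Exponential

variable {q : ℝ≥0∞} [Fact (1 ≤ q)]

theorem locInt_coeFn (u : LpHalf q) : LocInt u := by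
  intro b hb
  rw [intervalIntegrable_iff_integrableOn_Ioc_of_le hb.le]
  have h1 : MemLp u q (volume.restrict (Ioc 0 b)) :=
    (Lp.memLp u).mono_measure (Measure.restrict_mono Ioc_subset_Ioi_self le_rfl)
  exact h1.integrable Fact.out

theorem integral_greenKernel {T : ℝ} (hT : 0 ≤ T) {θ η f g u : ℝ → ℂ} {t : ℝ} (ht : 0 ≤ t)
    (hf : Integrable (fun s => f s * u s) halfLine) (hg : LocInt fun s => g s * u s) :
    ∫ s, greenKernel T θ η f g t s * u s ∂halfLine
      = θ t * (∫ s in T..t, g s * u s) + η t * ∫ s in Ioi t, f s * u s := by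
  have i1 : Integrable ((Ioc T t).indicator fun s => θ t * (g s * u s)) halfLine := by
    rw [integrable_indicator_iff measurableSet_Ioc]
    exact ((hg.intervalIntegrable hT ht).1.mono_measure Measure.restrict_le_self).const_mul _
  have i2 : Integrable ((Ioc t T).indicator fun s => θ t * (g s * u s)) halfLine := by
    rw [integrable_indicator_iff measurableSet_Ioc]
    exact ((hg.intervalIntegrable hT ht).2.mono_measure Measure.restrict_le_self).const_mul _
  have i3 : Integrable ((Ioi t).indicator fun s => η t * (f s * u s)) halfLine :=
    (hf.const_mul _).indicator measurableSet_Ioi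
  have e : ∀ s, greenKernel T θ η f g t s * u s
      = (Ioc T t).indicator (fun s => θ t * (g s * u s)) s
        - (Ioc t T).indicator (fun s => θ t * (g s * u s)) s
        + (Ioi t).indicator (fun s => η t * (f s * u s)) s := by
    intro s
    simp only [greenKernel, indicator_apply, mem_Ioc, mem_Ioi]
    rw [add_mul, sub_mul, ite_mul, ite_mul, ite_mul, zero_mul, mul_assoc, mul_assoc]
  have i12 : Integrable (fun s => (Ioc T t).indicator (fun s => θ t * (g s * u s)) s
      - (Ioc t T).indicator (fun s => θ t * (g s * u s)) s) halfLine := i1.sub i2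
  simp_rw [e]
  rw [integral_add i12 i3, integral_sub i1 i2, integral_indicator measurableSet_Ioc,
    integral_indicator measurableSet_Ioc, integral_indicator measurableSet_Ioi,
    Measure.restrict_restrict measurableSet_Ioc, Measure.restrict_restrict measurableSet_Ioc,
    Measure.restrict_restrict measurableSet_Ioi,
    inter_eq_left.2 (Ioc_subset_Ioi_self.trans (Ioi_subset_Ioi hT)),
    inter_eq_left.2 (Ioc_subset_Ioi_self.trans (Ioi_subset_Ioi ht)),
    inter_eq_left.2 (Ioi_subset_Ioi ht), integral_const_mul, integral_const_mul, integral_const_mul,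
    intervalIntegral, mul_sub]

/-- Starting the g-integral at T instead of 0 changes the solution only by a multiple of f, which
decays in the application, so a right inverse is still obtained. In exchange, for t > a with a ≤ T,
the values of u on (0, a] do not enter. -/
theorem isSol_green {T : ℝ} (hT : 0 ≤ T) {W f f' g g' u : ℝ → ℂ} (hW : LocInt W)
    (h : IsFundPair W f f' g g') (hf : Integrable (fun s => f s * u s) halfLine)
    (hg : LocInt fun s => g s * u s) :
    IsSol W (fun t => -u t)
      (fun t => f t * (∫ s in T..t, g s * u s) + g t * ∫ s in Ioi t, f s * u s)
      (fun t => f' t * (∫ s in T..t, g s * u s) + g' t * ∫ s in Ioi t, f s * u s) := by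
  obtain ⟨a1, a2⟩ := locAC_of_integral (F := fun t => ∫ s in T..t, g s * u s) hg fun t ht => by
    rw [intervalIntegral.integral_add_adjacent_intervals (hg.intervalIntegrable hT le_rfl)
      (hg.intervalIntegrable le_rfl ht)]
  obtain ⟨b1, b2⟩ := locAC_of_integral (F := fun t => ∫ s in Ioi t, f s * u s)
    (f := fun s => -(f s * u s)) (locInt_of_integrable hf.neg) fun t ht => by
      rw [intervalIntegral.integral_neg, integral_zero_to_eq hf ht]
      ring
  have hl := h.left.isSol hW
  have hr := h.right.isSol hW
  refine ⟨(hl.ac.mul a1).add (hr.ac.mul b1), (hl.ac'.mul a1).add (hr.ac'.mul b1), ?_, ?_⟩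
  · filter_upwards [a2, b2, hl.deriv, hr.deriv] with t h1 h2 h3 h4
    refine ((h3.mul h1).add (h4.mul h2)).congr_deriv ?_
    ring
  · filter_upwards [a2, b2, hl.deriv', hr.deriv', ae_restrict_mem measurableSet_Ioi]
      with t h1 h2 h3 h4 ht
    refine ((h3.mul h1).add (h4.mul h2)).congr_deriv ?_
    have hw := h.wr t (le_of_lt ht)
    linear_combination (-u t) * hw

/-- On (T, ∞) the weight contributes (1 + T)^(-δ) against a Schur bound independent of T, so the
tail is small for large T. The block constant may depend on T, which is fixed by then. -/
theorem exists_isUnit_greenKernel (hq : q ≠ ∞) {δ : ℝ} (hδ : 0 < δ) {c C : ℝ} {f f' g g' : ℝ → ℂ}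
    (hf : Continuous f) (hf' : Continuous f') (hg : Continuous g) (hg' : Continuous g')
    (h : IsDichotomy c C f g f g) (h' : IsDichotomy c C f' g' f g)
    {D Q₁ Q₂ : LpHalf q →L[ℂ] LpHalf q} (hQ₁ : ∀ A, IsTriangular A Q₁)
    (hQ₂ : ∀ A, IsTriangular A Q₂) (hD : ∀ u, D u =ᵐ[halfLine] fun t => wt δ t * u t)
    (hDn : ∀ T, 0 ≤ T → ‖cut (Ioi T) * D‖ ≤ (1 + T) ^ (-δ)) :
    ∃ T, 0 ≤ T ∧ ∃ G₁ G₂ : LpHalf q →L[ℂ] LpHalf q,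
      (∀ u, G₁ u =ᵐ[halfLine] fun t => ∫ s, greenKernel T f g f g t s * u s ∂halfLine) ∧
      (∀ u, G₂ u =ᵐ[halfLine] fun t => ∫ s, greenKernel T f' g' f g t s * u s ∂halfLine) ∧
      IsUnit (1 + (D * Q₁ * G₁ + D * Q₂ * G₂)) := by
  set J : ℝ := C ^ 2 * ∫ x : ℝ, Real.exp (-(c * |x|)) with hJ
  have hJ0 : 0 ≤ J := mul_nonneg (sq_nonneg _) (integral_nonneg fun x => (Real.exp_pos _).le)
  have hlim : Tendsto (fun T : ℝ => (1 + T) ^ (-δ) * ((‖Q₁‖ + ‖Q₂‖) * J)) atTop (𝓝 0) := by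
    have h1 : Tendsto (fun s : ℝ => 1 + s) atTop atTop := tendsto_atTop_add_const_left _ _ tendsto_id
    have h2 := (tendsto_rpow_neg_atTop hδ).comp h1
    simpa [Function.comp_def] using h2.mul_const ((‖Q₁‖ + ‖Q₂‖) * J)
  obtain ⟨T, hT1, hT⟩ := ((hlim.eventually (gt_mem_nhds one_pos)).and (eventually_ge_atTop 0)).exists
  have hm := measurable_greenKernel (T := T) hf hg hf hg
  have hm' := measurable_greenKernel (T := T) hf' hg' hf hg
  obtain ⟨B, hB⟩ := h.exists_schurBound T
  obtain ⟨B', hB'⟩ := h'.exists_schurBound T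
  obtain ⟨G₁, hG₁⟩ := (isBoundedKernel_of_schur hq hm hB).exists_clm
  obtain ⟨G₂, hG₂⟩ := (isBoundedKernel_of_schur hq hm' hB').exists_clm
  refine ⟨T, hT, G₁, G₂, hG₁, hG₂, ?_⟩
  have tri : ∀ (θ η : ℝ → ℂ) (G : LpHalf q →L[ℂ] LpHalf q),
      (∀ u, G u =ᵐ[halfLine] fun t => ∫ s, greenKernel T θ η f g t s * u s ∂halfLine) →
      IsTriangular (Icc 0 T) G := by
    intro θ η G hG
    refine isTriangular_of_kernel hG fun a ha => .of_forall fun t => .of_forall fun s hat hsa => ?_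
    have h1 : ¬ (t < s) := not_lt.2 (hsa.trans hat.le)
    have h2 : ¬ (T < s) := not_lt.2 (hsa.trans ha.2)
    simp [greenKernel, h1, h2]
  have hDtri : ∀ A, IsTriangular A D := fun A => isTriangular_of_mul hD
  have htail : ∀ (θ η : ℝ → ℂ) (Q G : LpHalf q →L[ℂ] LpHalf q), (∀ A, IsTriangular A Q) →
      Measurable (Function.uncurry (greenKernel T θ η f g)) → IsDichotomy c C θ η f g →
      (∀ u, G u =ᵐ[halfLine] fun t => ∫ s, greenKernel T θ η f g t s * u s ∂halfLine) →
      ‖cut (Ioi T) * (D * Q * G) * cut (Ioi T)‖ ≤ (1 + T) ^ (-δ) * (‖Q‖ * J) := by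
    intro θ η Q G hQ hk hd hG
    refine (norm_cut_mul_mul_cut_le_of_isTriangular (mem_univ T)
      ((hDtri univ).mul (hQ univ))).trans ?_
    have h1 := norm_cut_mul_mul_cut_le hq hk measurableSet_Ioi (Ioi_subset_Ioi hT) hG
      (hd.schurBound_tail hT)
    rw [Real.coe_toNNReal _ hJ0] at h1
    rw [← mul_assoc (cut (Ioi T)), ← mul_assoc]
    refine mul_le_mul ((norm_mul_le _ _).trans ?_) h1 (norm_nonneg _)
      (mul_nonneg (Real.rpow_nonneg (by linarith) _) (norm_nonneg _))
    exact mul_le_mul_of_nonneg_right (hDn T hT) (norm_nonneg _)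
  have hloc : ∀ (θ η : ℝ → ℂ) (G : LpHalf q →L[ℂ] LpHalf q),
      Measurable (Function.uncurry (greenKernel T θ η f g)) → IsDichotomy c C θ η f g →
      (∀ u, G u =ᵐ[halfLine] fun t => ∫ s, greenKernel T θ η f g t s * u s ∂halfLine) →
      ∀ a b, 0 ≤ a → a ≤ b → b ≤ T → ‖cut (Ioc a b) * G * cut (Ioc a b)‖
        ≤ (C ^ 2 + C ^ 2 * Real.exp (c * T)) * (b - a) := by
    intro θ η G hk hd hG a b ha hab _
    have hK : 0 ≤ C ^ 2 + C ^ 2 * Real.exp (c * T) := by positivity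
    have h1 := norm_cut_mul_mul_cut_le hq hk measurableSet_Ioc
      (fun t ht => ha.trans_lt ht.1) hG (schurBound_Ioc (a := a) (b := b) hK ha
        fun t s ht hs => hd.norm_greenKernel_le_const ht hs)
    rwa [Real.coe_toNNReal _ (mul_nonneg hK (by linarith))] at h1
  refine isUnit_one_add_of_isTriangular hT ((hDtri _).mul (hQ₁ _)) ((hDtri _).mul (hQ₂ _))
    (tri _ _ _ hG₁) (tri _ _ _ hG₂) ?_ (hloc _ _ _ hm h hG₁) (hloc _ _ _ hm' h' hG₂)
  rw [mul_add, add_mul]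
  refine (norm_add_le _ _).trans_lt ((add_le_add (htail _ _ _ _ hQ₁ hm h hG₁)
    (htail _ _ _ _ hQ₂ hm' h' hG₂)).trans_lt ?_)
  rw [← mul_add, ← add_mul]
  exact hT1

/-- If the multipliers do not have modulus one, `H - z` has a bounded right inverse. -/
theorem IsCanonical.exists_right_inverse {V b₁ b₂ : ℝ → ℂ} {k₁ k₂ : ℝ → ℝ → ℂ} {z : ℂ}
    {φ φ' ψ ψ' : ℝ → ℂ} (h : IsCanonical (fun t => V t - z) φ φ' ψ ψ') {ρ : ℂ} (hρ0 : ρ ≠ 0)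
    (hρ : ‖ρ‖ < 1) (hrec : ∀ u v, IsHomSol (fun t => V t - z) u v → Recur ρ u ∧ Recur ρ v)
    (hq : q ≠ ∞) (hV : MemLp V ∞ volume) {δ : ℝ} (hδ : 0 < δ) {D Q₁ Q₂ : LpHalf q →L[ℂ] LpHalf q}
    (hQ₁ : ∀ A, IsTriangular A Q₁) (hQ₂ : ∀ A, IsTriangular A Q₂)
    (hD : ∀ u, D u =ᵐ[halfLine] fun t => wt δ t * u t)
    (hDn : ∀ T, 0 ≤ T → ‖cut (Ioi T) * D‖ ≤ (1 + T) ^ (-δ))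
    (hP : IsPerturbation b₁ b₂ k₁ k₂ (D * Q₁) (D * Q₂)) :
    ∃ S : LpHalf q →L[ℂ] LpHalf q, ∀ x, IsHill V b₁ b₂ k₁ k₂ (S x) (x + z • S x) := by
  obtain ⟨c, hc, C, hC, f, f', g, g', hfund, hb⟩ := h.exists_dichotomy hρ0 hρ hrec
  have hd : IsDichotomy c C f g f g := ⟨hc, hC, fun t ht => (hb t ht).1,
    fun t ht => (hb t ht).2.2.1, fun t ht => (hb t ht).1, fun t ht => (hb t ht).2.2.1⟩
  have hd' : IsDichotomy c C f' g' f g := ⟨hc, hC, fun t ht => (hb t ht).2.1,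
    fun t ht => (hb t ht).2.2.2, fun t ht => (hb t ht).1, fun t ht => (hb t ht).2.2.1⟩
  obtain ⟨T, hT, G₁, G₂, hG₁, hG₂, ⟨U, hU⟩⟩ := exists_isUnit_greenKernel hq hδ hfund.left.cont
    hfund.left.cont' hfund.right.cont hfund.right.cont' hd hd' hQ₁ hQ₂ hD hDn
  -- (H - z) G₁ = 1 + D Q₁ G₁ + D Q₂ G₂ = U, because G₂ y is the derivative of G₁ y.
  refine ⟨G₁ * ↑U⁻¹, fun x => ?_⟩
  set y := (↑U⁻¹ : LpHalf q →L[ℂ] LpHalf q) x with hy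
  have hUy : y + ((D * Q₁) (G₁ y) + (D * Q₂) (G₂ y)) = x := by
    have : (↑U * ↑U⁻¹ : LpHalf q →L[ℂ] LpHalf q) x = x := by simp
    rw [mul_apply_eq_comp, ← hy, hU] at this
    simpa only [add_apply, mul_apply_eq_comp, one_apply_eq_self] using this
  have hfy := hd.integrable_f_mul hfund.left.cont hq y
  have hgy : LocInt fun s => g s * y s := by
    simpa only [mul_comm] using (locInt_coeFn y).mul_continuous hfund.right.cont
  have hsol := isSol_green hT h.locInt hfund hfy hgy
  have := isHill_of_isSol hP hV hsol (u := G₁ y) (u' := G₂ y) (by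
      filter_upwards [hG₁ y, ae_restrict_mem measurableSet_Ioi] with t h1 ht
      rw [h1, integral_greenKernel hT (le_of_lt ht) hfy hgy]) (by
      filter_upwards [hG₂ y, ae_restrict_mem measurableSet_Ioi] with t h1 ht
      rw [h1, integral_greenKernel hT (le_of_lt ht) hfy hgy])
  rw [mul_apply_eq_comp, ← hy]
  convert this using 1
  rw [← hUy]
  abel

end Exponential

/-! ### Conclusion. -/

theorem exists_isCanonical {W : ℝ → ℂ} (hW : MemLp W ∞ volume) (hper : ∀ t, W (t + 1) = W t) :
    ∃ φ φ' ψ ψ', IsCanonical W φ φ' ψ ψ' := by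
  have hL : ∀ᵐ t, ‖W t‖ ≤ (eLpNorm W ∞ volume).toReal := by
    filter_upwards [ae_le_eLpNormEssSup (f := W)] with t ht
    rw [← eLpNorm_exponent_top] at ht
    have := ENNReal.toReal_mono hW.2.ne ht
    rwa [toReal_enorm] at this
  obtain ⟨φ, φ', hφ, h1, h2⟩ := exists_isHomSol hW.1 hL 1 0
  obtain ⟨ψ, ψ', hψ, h3, h4⟩ := exists_isHomSol hW.1 hL 0 1
  refine ⟨φ, φ', ψ, ψ', ?_, hper, hφ, hψ, h1, h2, h3, h4⟩
  intro b hb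
  rw [intervalIntegrable_iff_integrableOn_Ioc_of_le hb.le]
  exact (hW.restrict (Ioc 0 b)).integrable le_top

/-- If `T - z` has a bounded right inverse, then so does `T - z'` for `z'` close to `z`. -/
theorem notMem_closure_continuousSpectrum {E : Type*} [NormedAddCommGroup E] [NormedSpace ℂ E]
    [CompleteSpace E] {A : E → E → Prop} {z : ℂ} {S : E →L[ℂ] E}
    (hS : ∀ x, A (S x) (x + z • S x)) : z ∉ closure (continuousSpectrum A) := by
  rw [Metric.mem_closure_iff]
  push Not
  refine ⟨(‖S‖ + 1)⁻¹, by positivity, fun y hy => ?_⟩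
  by_contra! hlt
  apply hy
  have hn : ‖(z - y) • S‖ < 1 := by
    rw [norm_smul, ← dist_eq_norm]
    calc dist z y * ‖S‖ ≤ (‖S‖ + 1)⁻¹ * ‖S‖ := by gcongr
      _ < 1 := by
        rw [inv_mul_lt_iff₀ (by positivity)]
        linarith
  obtain ⟨U, hU⟩ := isUnit_one_add_of_norm_lt_one hn
  -- (A - y) S x = x + (z - y) S x, and the right-hand side is an invertible function of x by the
  -- Neumann series. So the range is everything, in particular closed.
  have huniv : rangeSub A y = univ := by
    refine eq_univ_of_forall fun f => ?_
    set x := (↑U⁻¹ : E →L[ℂ] E) f with hx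
    have h1 : x + (z - y) • S x = f := by
      have : (↑U * ↑U⁻¹ : E →L[ℂ] E) f = f := by simp
      rw [mul_apply_eq_comp, ← hx, hU] at this
      simpa only [add_apply, one_apply_eq_self, smul_apply] using this
    refine ⟨S x, x + z • S x, hS x, ?_⟩
    rw [← h1]
    module
  rw [huniv]
  exact isClosed_univ

end Hill

theorem mainTheorem4 (q : ℝ≥0∞) [Fact (1 ≤ q)] (hq : q ≠ ∞)
    (V b₁ b₂ : ℝ → ℂ) (k₁ k₂ : ℝ → ℝ → ℂ) (δ : ℝ) (hδ : 2 < δ)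
    (hV : MemLp V ∞ volume) (hVper : ∀ t, V (t + 1) = V t)
    (hb₁ : MemLp (fun t => (((1 + t) ^ δ : ℝ) : ℂ) * b₁ t) ∞ Hill.halfLine)
    (hb₂ : MemLp (fun t => (((1 + t) ^ δ : ℝ) : ℂ) * b₂ t) ∞ Hill.halfLine)
    (hk₁ : MemLp (Function.uncurry k₁) ∞ (Hill.halfLine.prod Hill.halfLine))
    (hk₂ : MemLp (Function.uncurry k₂) ∞ (Hill.halfLine.prod Hill.halfLine))
    (hk₁tri : ∀ᵐ z : ℝ × ℝ ∂(Hill.halfLine.prod Hill.halfLine), z.2 < z.1 → k₁ z.1 z.2 = 0)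
    (hk₂tri : ∀ᵐ z : ℝ × ℝ ∂(Hill.halfLine.prod Hill.halfLine), z.2 < z.1 → k₂ z.1 z.2 = 0)
    (hk₁bdd : Hill.IsBoundedKernel q (fun t s => (((1 + t) ^ δ : ℝ) : ℂ) * k₁ t s))
    (hk₂bdd : Hill.IsBoundedKernel q (fun t s => (((1 + t) ^ δ : ℝ) : ℂ) * k₂ t s))
    (z : ℂ)
    (hz : Hill.IsExtremePoint
      (Hill.continuousSpectrum (E := Hill.LpHalf q) (Hill.IsHill V b₁ b₂ k₁ k₂)) z) :
    ¬ Hill.IsEigenvalue (E := Hill.LpHalf q) (Hill.IsHill V b₁ b₂ k₁ k₂) z := by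
  rintro ⟨u, hu0, hu⟩
  have hδ0 : 0 < δ := by linarith
  obtain ⟨φ, φ', ψ, ψ', hcan⟩ := Hill.exists_isCanonical (W := fun t => V t - z)
    (hV.sub (memLp_top_const z)) (fun t => by rw [hVper])
  obtain ⟨ρ, hρ0, hρ1, hrec⟩ := hcan.exists_multiplier
  obtain ⟨D, hD, hDn⟩ := Hill.exists_weight_clm (q := q) hδ0.le
  obtain ⟨R₁, hR₁t, hR₁⟩ := Hill.exists_perturbation_clm hb₁ hk₁tri hk₁bdd
  obtain ⟨Q₁, hQ₁t, hQ₁⟩ := Hill.exists_perturbation_clm hb₂ hk₂tri hk₂bdd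
  have hQ₂t : ∀ A, Hill.IsTriangular A (Complex.I • R₁) := fun A => (hR₁t A).smul _
  have hP : Hill.IsPerturbation b₁ b₂ k₁ k₂ (D * Q₁) (D * (Complex.I • R₁)) := by
    constructor
    · intro x
      filter_upwards [hD (Q₁ x), hQ₁ x] with t h1 h2
      rw [mul_apply_eq_comp, h1, h2]
    · intro x
      filter_upwards [hD (R₁ (Complex.I • x)), hR₁ (Complex.I • x)] with t h1 h2
      rw [mul_apply_eq_comp, smul_apply, ← map_smul, h1, h2]
  -- |ρ| < 1 would put z outside the closure of the continuous spectrum; |ρ| = 1 forces u = 0.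
  rcases hρ1.lt_or_eq with hρ | hρ
  · obtain ⟨S, hS⟩ := hcan.exists_right_inverse hρ0 hρ hrec hq hV hδ0 hQ₁t hQ₂t hD hDn hP
    exact Hill.notMem_closure_continuousSpectrum hS hz.1
  · obtain ⟨u', w, v, hsol, hw, hv⟩ := Hill.exists_isSol_of_isHill hP hu
    refine hu0 (hcan.eq_zero_of_isSol hρ hrec hq hδ hQ₁t hQ₂t ⟨hsol.ac, hsol.ac', hsol.deriv, ?_⟩
      hw hv)
    filter_upwards [hsol.deriv', hD (Q₁ u + (Complex.I • R₁) u')] with t h1 h2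
    rw [← h2, map_add]
    exact h1
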